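/- Let $r\ge 2$ and $0\le n_{\rm cp}<r-1$ be integers. For $s=0,\dots,r-1$ let $d_s=\binom{r}{s}\binom{r-1}{s}/\binom{2r-1}{r}$ be the ideal weights of the $(2r-1)$th-order WENO reconstruction, let $\widetilde d_0=\min_s d_s$, and let $0<\mathrm{CFS}_s<\widetilde d_0$ and $k_s\in[0,d_s/\mathrm{CFS}_s]$. *The scheme.* On a uniform mesh with cells $I_j=[x_{j-1/2},x_{j+1/2}]$, centres $x_j$, width $\Delta x$ and cell averages $\bar u_j$, let $p_s$ be the polynomial of degree less than $r$ whose averages over the cells $I_{j+s-r+1},\dots,I_{j+s}$ are the given ones, and put $u^s_{j+1/2}=p_s(x_{j+1/2})$, $\beta_s=\sum_{l=1}^{r-1}\Delta x^{2l-1}\int_{I_j}(p_s^{(l)})^2\,dx$. With $\epsilon\ge 0$ let $\omega_s^{\rm JS}=\alpha_s/\sum_{l=0}^{r-1}\alpha_l$, where $\alpha_s=d_s/(\epsilon+\beta_s)^2$. For an index $i$ put $$g_i(\omega)=\begin{cases}k_i\,\omega,&\omega<\mathrm{CFS}_i,\\ d_i,&\mathrm{CFS}_i\le\omega\le\overline{\mathrm{CFS}}_i,\\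 1-k_i(1-\omega),&\omega>\overline{\mathrm{CFS}}_i,\end{cases}\qquad \overline{\mathrm{CFS}}_i=1-\frac{1-d_i}{d_i}\mathrm{CFS}_i ,$$ and $g^{\rm MOP}(\omega)=g_{k^*}(\omega)$, where $k^*=k^*(\omega)$ is the smallest index minimizing $|\omega-d_i|$ over $i=0,\dots,r-1$. The MOP-WENO-ACM$k$ weights are $\omega_s=g^{\rm MOP}(\omega^{\rm JS}_s)/\sum_{l=0}^{r-1} g^{\rm MOP}(\omega_l^{\rm JS})$ and the reconstruction is $u^-_{j+1/2}=\sum_{s=0}^{r-1}\omega_s u^s_{j+1/2}$; $u^+_{j+1/2}$ is obtained by mirror symmetry about $x_{j+1/2}$. For the conservation law $u_t+f(u)_x=0$ and a constant $\alpha\in\mathbb R$, the semi-discrete scheme is $\frac{d\bar u_j}{dt}=\mathcal L_j(\bar u):=-\frac1{\Delta x}(\hat f_{j+1/2}-\hat f_{j-1/2})$ with the Lax–Friedrichs flux $\hat f_{j+1/2}=\frac12\big[f(u^-_{j+1/2})+f(u^+_{j+1/2})-\alpha(u^+_{j+1/2}-u^-_{j+1/2})\big]$. *The result.* Let $x_c\in\mathbb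 R$, let $u:\mathbb R\to\mathbb R$ be of class $C^{2r}$ near $x_c$, let $f:\mathbb R\to\mathbb R$ be of class $C^2$ near $u(x_c)$, and suppose that $x_c$ is a critical point of $u$ of order $n_{\rm cp}$, i.e. $u^{(l)}(x_c)=0$ for $1\le l\le n_{\rm cp}$ and $u^{(n_{\rm cp}+1)}(x_c)\ne0$ (so $u'(x_c)\neq 0$ if $n_{\rm cp}=0$). Then the $(2r-1)$th-order MOP-WENO-ACM$k$ scheme has the optimal order of accuracy $2r-1$ at and near $x_c$: there are constants $C,h_0,\delta>0$ such that for every $\epsilon\ge0$, every uniform mesh with $0<\Delta x<h_0$ and every cell with $|x_j-x_c|<\delta$, the scheme applied to the exact cell averages $\bar u_j=\frac1{\Delta x}\int_{I_j}u\,dx$ satisfies $$|u^{-}_{j+1/2}-u(x_{j+1/2})|\le C\Delta x^{2r-1},\qquad |u^{+}_{j+1/2}-u(x_{j+1/2})|\le C\Delta x^{2r-1},$$ $$\Big|\mathcal L_j(\bar u)+\frac{f(u(x_{j+1/2}))-f(u(x_{j-1/2}))}{\Delta x}\Big|\le C\Delta x^{2r-1}.$$ -/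

import Mathlib

noncomputable section

namespace MopWeno

/-! ### Reconstruction polynomials from cell averages

Scaled coordinate `ξ = (x - x_j) / Δx`: the cell `I_{j+i}` is `[i - 1/2, i + 1/2]`.
A stencil is described by the cell averages `v i` of the cells `I_{j+i}`, `i : ℤ`. -/

/-- The polynomial `p` of degree `< m` with `∫_{i-1/2}^{i+1/2} p = v i` on the `m` consecutive cells
`i = a, …, a + m - 1`: the derivative of the interpolant of the primitive, whose values at the cell
boundaries `a - 1/2, …, a + m - 1/2` are the partial sums of the averages. -/
def reconPoly (a : ℤ) (m : ℕ) (v : ℤ → ℝ) : Polynomial ℝ :=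
  Polynomial.derivative
    (Lagrange.interpolate (Finset.range (m + 1)) (fun k : ℕ => (a : ℝ) + (k : ℝ) - 1 / 2)
      (fun k : ℕ => ∑ i ∈ Finset.range k, v (a + (i : ℤ))))

/-- The reconstruction polynomial of the `r`-point substencil
`S_s = {I_{j+s-r+1}, …, I_{j+s}}`, `s = 0, …, r - 1`. -/
def subPoly (r s : ℕ) (v : ℤ → ℝ) : Polynomial ℝ :=
  reconPoly ((s : ℤ) - (r : ℤ) + 1) r v

/-- The `r`-th order approximation `u^s_{j+1/2}` given by the substencil `S_s`. -/
def subValue (r s : ℕ) (v : ℤ → ℝ) : ℝ :=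
  (subPoly r s v).eval (1 / 2)

/-- The smoothness indicator of Jiang and Shu,
`β_s = ∑_{l=1}^{r-1} Δx^{2l-1} ∫_{I_j} (d^l p_s / dx^l)² dx`, in the scaled coordinate `ξ`
(in which the powers of `Δx` cancel). -/
def smoothInd (r s : ℕ) (v : ℤ → ℝ) : ℝ :=
  ∑ l ∈ Finset.Icc 1 (r - 1),
    ∫ ξ in (-(1 / 2) : ℝ)..(1 / 2), ((Polynomial.derivative^[l] (subPoly r s v)).eval ξ) ^ 2

/-! ### Weights -/

/-- The ideal weights `d_s`, `s = 0, …, r - 1`, i.e. the coefficients for which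
`∑ s, d_s u^s_{j+1/2}` is the value at `x_{j+1/2}` of the reconstruction polynomial of the whole
`(2r-1)`-point stencil; in closed form (`1/10, 6/10, 3/10` for `r = 3`). -/
def idealWeight (r s : ℕ) : ℝ :=
  ((r.choose s : ℝ) * ((r - 1).choose s : ℝ)) / ((2 * r - 1).choose r : ℝ)

/-- Unnormalized WENO-JS weights. -/
def alphaJS (r : ℕ) (ε : ℝ) (v : ℤ → ℝ) (s : ℕ) : ℝ :=
  idealWeight r s / (ε + smoothInd r s v) ^ 2

/-- The nonlinear weights of the WENO-JS scheme. -/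
def omegaJS (r : ℕ) (ε : ℝ) (v : ℤ → ℝ) (s : ℕ) : ℝ :=
  alphaJS r ε v s / ∑ l ∈ Finset.range r, alphaJS r ε v l

/-- The mapping function of MIP-WENO-ACM`k` with the parameters `d`, `CFS`, `k`. -/
def gACMk (d cfs k ω : ℝ) : ℝ :=
  if ω < cfs then k * ω
  else if ω ≤ 1 - (1 - d) / d * cfs then d
  else 1 - k * (1 - ω)

/-- The index `k*` of the `minDist` function: the smallest index `k < r` for which `|ω - d_k|` is
minimal. -/
def minDistIndex (r : ℕ) (d : ℕ → ℝ) (ω : ℝ) : ℕ :=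
  sInf {k : ℕ | k < r ∧ ∀ i < r, |ω - d k| ≤ |ω - d i|}

/-- The `minDist` function `minDist (x_0, …, x_{r-1}; d_0, …, d_{r-1}; ω)`. -/
def minDist (r : ℕ) (x d : ℕ → ℝ) (ω : ℝ) : ℝ :=
  x (minDistIndex r d ω)

/-- The order-preserving mapping MOP-ACM`k`: every `s`-dependent parameter of the mapping function
is replaced by the one selected by `minDist`. -/
def gMOP (r : ℕ) (cfs k : ℕ → ℝ) (ω : ℝ) : ℝ :=
  gACMk (minDist r (idealWeight r) (idealWeight r) ω) (minDist r cfs (idealWeight r) ω)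
    (minDist r k (idealWeight r) ω) ω

/-- The nonlinear weights of the MOP-WENO-ACM`k` scheme. -/
def omegaMOP (r : ℕ) (ε : ℝ) (cfs k : ℕ → ℝ) (v : ℤ → ℝ) (s : ℕ) : ℝ :=
  gMOP r cfs k (omegaJS r ε v s) / ∑ l ∈ Finset.range r, gMOP r cfs k (omegaJS r ε v l)

/-! ### The scheme -/

/-- The MOP-WENO-ACM`k` reconstruction at the right boundary `ξ = 1/2` of the cell `0`, biased to the
left. -/
def reconstruct (r : ℕ) (ε : ℝ) (cfs k : ℕ → ℝ) (v : ℤ → ℝ) : ℝ :=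
  ∑ s ∈ Finset.range r, omegaMOP r ε cfs k v s * subValue r s v

/-- `u⁻_{j+1/2}`, from the cell averages `ubar` on the grid. -/
def uMinus (r : ℕ) (ε : ℝ) (cfs k : ℕ → ℝ) (ubar : ℤ → ℝ) (j : ℤ) : ℝ :=
  reconstruct r ε cfs k (fun i => ubar (j + i))

/-- `u⁺_{j+1/2}`: the mirror image of `u⁻_{j+1/2}` with respect to `x_{j+1/2}`. -/
def uPlus (r : ℕ) (ε : ℝ) (cfs k : ℕ → ℝ) (ubar : ℤ → ℝ) (j : ℤ) : ℝ :=
  reconstruct r ε cfs k (fun i => ubar (j + 1 - i))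

/-- The Lax–Friedrichs flux. -/
def lxFlux (f : ℝ → ℝ) (α a b : ℝ) : ℝ :=
  (f a + f b - α * (b - a)) / 2

/-- The numerical flux `f̂_{j+1/2}`. -/
def numFlux (r : ℕ) (ε : ℝ) (cfs k : ℕ → ℝ) (f : ℝ → ℝ) (α : ℝ) (ubar : ℤ → ℝ) (j : ℤ) : ℝ :=
  lxFlux f α (uMinus r ε cfs k ubar j) (uPlus r ε cfs k ubar j)

/-- The semi-discrete finite volume operator `-(f̂_{j+1/2} - f̂_{j-1/2}) / Δx`. -/
def schemeOp (r : ℕ) (ε : ℝ) (cfs k : ℕ → ℝ) (f : ℝ → ℝ) (α h : ℝ) (ubar : ℤ → ℝ) (j : ℤ) : ℝ :=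
  -(1 / h) * (numFlux r ε cfs k f α ubar j - numFlux r ε cfs k f α ubar (j - 1))

/-- The centre `x_j` of the cell `I_j = [xl + (j - 1) h, xl + j h]`. -/
def cellCenter (xl h : ℝ) (j : ℤ) : ℝ := xl + ((j : ℝ) - 1 / 2) * h

/-- The exact cell averages of `u` on the uniform grid. -/
def cellAvg (u : ℝ → ℝ) (xl h : ℝ) (j : ℤ) : ℝ :=
  (1 / h) * ∫ x in (cellCenter xl h j - h / 2)..(cellCenter xl h j + h / 2), u x

/-- `x` is a critical point of order `n` of `u`: `u'(x) = ⋯ = u⁽ⁿ⁾(x) = 0`, `u⁽ⁿ⁺¹⁾(x) ≠ 0`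
(for `n = 0`: `u'(x) ≠ 0`). -/
def IsCritOrder (u : ℝ → ℝ) (n : ℕ) (x : ℝ) : Prop :=
  (∀ l : ℕ, 1 ≤ l → l ≤ n → iteratedDeriv l u x = 0) ∧ iteratedDeriv (n + 1) u x ≠ 0

end MopWeno

end

namespace MopWeno

open Polynomial Finset
open scoped Topology

/-! For small `h` the mapped weights are not merely close to the ideal weights but equal to them, so
the scheme coincides with the linear one. Near `xc` every `β_s` is compared with the indicator `B`
of one Taylor polynomial of degree at most `r - 1`, which each substencil reproduces. The nonzero
derivative of order `ncp + 1 ≤ r - 1` keeps `B` above a multiple of `h ^ (2 * (r - 1))`, while the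
squared Taylor remainder is `O(h ^ (2 * r))`. All `β_s / B` therefore tend to 1, the JS weights tend
to `d_s`, and the mapping is constant near each `d_s` (`eventually_reconstruct_eq_linRecon`).
Working with `(ε + β_s) / (ε + B)` makes this uniform in `ε`.

The linear reconstruction is exact in degree at most `2 * r - 2`: its error is a difference of order
`2 * r - 1` (`sum_idealWeight_mul_subValue`). With stability and Taylor's formula this gives order
`2 * r - 1` (`exists_linError_le`).

The flux difference is divided by `h`, so one more power is needed: errors at neighbouring
boundaries differ by `O(h ^ (2 * r))` (`exists_linError_sub_le`), and a `C²` flux preserves this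
(`exists_flux_difference_le`). -/

/-! ### Cell averages and reconstruction of polynomials -/

/-- The averages of `w` over the cells `[i - 1/2, i + 1/2]`. -/
noncomputable def cellMean (w : ℝ → ℝ) (i : ℤ) : ℝ :=
  ∫ ξ in ((i : ℝ) - 1 / 2)..((i : ℝ) + 1 / 2), w ξ

theorem exists_derivative_eq (p : ℝ[X]) {m : ℕ} (hp : p.natDegree < m) :
    ∃ F : ℝ[X], derivative F = p ∧ F.natDegree ≤ m := by
  refine ⟨∑ k ∈ range m, C (p.coeff k / (k + 1)) * X ^ (k + 1), ?_, ?_⟩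
  · rw [derivative_sum]
    conv_rhs => rw [p.as_sum_range_C_mul_X_pow' hp]
    refine sum_congr rfl fun k _ => ?_
    rw [derivative_C_mul_X_pow]
    have : (k : ℝ) + 1 ≠ 0 := by positivity
    simp [this]
  · refine natDegree_sum_le_of_forall_le _ _ fun k hk => ?_
    exact (natDegree_C_mul_X_pow_le _ _).trans (by simpa using hk)

theorem sum_cellMean_derivative (F : ℝ[X]) (a : ℤ) (k : ℕ) :
    ∑ i ∈ range k, cellMean (fun ξ => (derivative F).eval ξ) (a + (i : ℤ))
      = F.eval ((a : ℝ) + k - 1 / 2) - F.eval ((a : ℝ) - 1 / 2) := by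
  induction k with
  | zero => simp
  | succ k ih =>
    rw [sum_range_succ, ih, cellMean,
      intervalIntegral.integral_eq_sub_of_hasDerivAt (fun x _ => F.hasDerivAt x)
        ((derivative F).continuous.intervalIntegrable _ _)]
    push_cast
    rw [show (a : ℝ) + k + 1 / 2 = a + (k + 1) - 1 / 2 by ring]
    ring

theorem injOn_node (a : ℤ) (m : ℕ) :
    Set.InjOn (fun k : ℕ => (a : ℝ) + (k : ℝ) - 1 / 2) (range (m + 1)) := by
  intro x _ y _ h
  simpa using h

/-- The partial sums of averages are values of `F` up to one additive constant, which the derivative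
removes. -/
theorem reconPoly_cellMean_derivative (F : ℝ[X]) (a : ℤ) (m : ℕ) :
    reconPoly a m (cellMean fun ξ => (derivative F).eval ξ)
      = derivative (Lagrange.interpolate (range (m + 1))
          (fun k : ℕ => (a : ℝ) + (k : ℝ) - 1 / 2)
          (fun k : ℕ => F.eval ((a : ℝ) + (k : ℝ) - 1 / 2))) := by
  have hC : C (F.eval ((a : ℝ) - 1 / 2)) = Lagrange.interpolate (range (m + 1))
      (fun k : ℕ => (a : ℝ) + (k : ℝ) - 1 / 2) (fun _ => F.eval ((a : ℝ) - 1 / 2)) := by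
    refine Lagrange.eq_interpolate_of_eval_eq _ (injOn_node a m) ?_ (by simp)
    refine degree_C_le.trans_lt ?_
    rw [card_range]
    exact_mod_cast Nat.succ_pos m
  have hsub : (fun k : ℕ => ∑ i ∈ range k,
      cellMean (fun ξ => (derivative F).eval ξ) (a + (i : ℤ)))
      = (fun k : ℕ => F.eval ((a : ℝ) + (k : ℝ) - 1 / 2)) - fun _ => F.eval ((a : ℝ) - 1 / 2) := by
    funext k
    exact sum_cellMean_derivative F a k
  rw [reconPoly, hsub, map_sub, ← hC, derivative_sub, derivative_C, sub_zero]

theorem reconPoly_cellMean_eval (p : ℝ[X]) (a : ℤ) {m : ℕ} (hp : p.natDegree < m) :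
    reconPoly a m (cellMean fun ξ => p.eval ξ) = p := by
  obtain ⟨F, rfl, hF⟩ := exists_derivative_eq p hp
  rw [reconPoly_cellMean_derivative, ← Lagrange.eq_interpolate (injOn_node a m)]
  refine degree_le_natDegree.trans_lt ?_
  rw [card_range]
  exact_mod_cast Nat.lt_succ_of_le hF

/-! ### Ideal weights and exactness of the linear reconstruction -/

theorem idealWeight_pos {r s : ℕ} (hs : s < r) : 0 < idealWeight r s := by
  have h1 := Nat.choose_pos hs.le
  have h2 := Nat.choose_pos (show s ≤ r - 1 by omega)
  have h3 := Nat.choose_pos (show r ≤ 2 * r - 1 by omega)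
  unfold idealWeight
  positivity

/-- This is Vandermonde's identity for `(2r - 1).choose (r - 1)`. -/
theorem sum_idealWeight {r : ℕ} (hr : 0 < r) : ∑ s ∈ range r, idealWeight r s = 1 := by
  have h3 := Nat.choose_pos (show r ≤ 2 * r - 1 by omega)
  unfold idealWeight
  rw [← sum_div, div_eq_one_iff_eq (by positivity)]
  norm_cast
  rw [← Nat.choose_symm (show r ≤ 2 * r - 1 by omega), show 2 * r - 1 - r = r - 1 by omega,
    show 2 * r - 1 = r + (r - 1) by omega, Nat.add_choose_eq,
    Finset.Nat.sum_antidiagonal_eq_sum_range_succ_mk, Nat.succ_eq_add_one,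
    Nat.sub_add_cancel hr]
  refine sum_congr rfl fun s hs => ?_
  rw [mem_range] at hs
  rw [Nat.choose_symm (show s ≤ r - 1 by omega)]

theorem idealWeight_lt_one {r s : ℕ} (hr : 2 ≤ r) (hs : s < r) : idealWeight r s < 1 := by
  rw [← sum_idealWeight (show 0 < r by omega)]
  obtain ⟨t, ht, hts⟩ : ∃ t < r, t ≠ s := by
    by_cases h : s = 0
    · exact ⟨1, by omega, by omega⟩
    · exact ⟨0, by omega, by omega⟩
  exact single_lt_sum (f := idealWeight r) hts (mem_range.2 hs) (mem_range.2 ht)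
    (idealWeight_pos ht) fun i hi _ => (idealWeight_pos (mem_range.1 hi)).le

/-- If `E` and `H` differ by a polynomial of degree `< r` and `E` vanishes at the integers
`s - r, …, s` except `0`, then the `r`-th difference of `H` at `s - r` determines `E 0`. -/
theorem fwdDiff_iter_eval_of_eval_eq_zero {r s : ℕ} (hs : s < r) (E H : ℝ[X])
    (hdeg : (H - E).natDegree < r)
    (hE : ∀ k ∈ range (r + 1), k ≠ r - s → E.eval ((s : ℝ) - r + k) = 0) :
    (fwdDiff 1)^[r] H.eval ((s : ℝ) - r) = (-1) ^ s * r.choose s * E.eval 0 := by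
  have h0 := congrFun (fwdDiff_iter_eq_zero_of_degree_lt hdeg) ((s : ℝ) - r)
  have hH : H.eval = (H - E).eval + E.eval := by
    funext x; simp
  -- Only the node 0, of index `k = r - s`, survives in the alternating sum.
  rw [hH, fwdDiff_iter_add, Pi.add_apply, h0, Pi.zero_apply, zero_add, fwdDiff_iter_eq_sum_shift,
    sum_eq_single_of_mem (r - s) (by simp)]
  · have h1 : r - (r - s) = s := by omega
    rw [h1, Nat.choose_symm hs.le]
    have h2 : (s : ℝ) - r + (r - s) • (1 : ℝ) = 0 := by
      rw [nsmul_eq_mul, Nat.cast_sub hs.le]; ring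
    rw [h2, zsmul_eq_mul]
    push_cast
    ring
  · intro k hk hne
    rw [nsmul_one, hE k hk hne, smul_zero]

theorem eval_derivative_eq_eval_divX (D : ℝ[X]) :
    (derivative D).eval 0 = D.divX.eval 0 := by
  rw [← coeff_zero_eq_eval_zero, ← coeff_zero_eq_eval_zero, coeff_derivative, coeff_divX]
  simp

theorem eval_mul_divX (D : ℝ[X]) (x : ℝ) : x * D.divX.eval x = D.eval x - D.eval 0 := by
  have h := congrArg (eval x) (X_mul_divX_add D)
  rw [eval_add, eval_mul, eval_X, eval_C, coeff_zero_eq_eval_zero] at h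
  linarith

/-- The error of the substencil value, for a polynomial, as an `r`-th order difference. -/
theorem idealWeight_mul_error {r s : ℕ} (hs : s < r) (F : ℝ[X]) :
    idealWeight r s * ((derivative F).eval (1 / 2)
        - subValue r s (cellMean fun ξ => (derivative F).eval ξ))
      = ((2 * r - 1).choose r : ℝ)⁻¹ * ((-1) ^ s * (r - 1).choose s *
        (fwdDiff 1)^[r] ((F.comp (X + C (1 / 2))).divX).eval ((s : ℝ) - r)) := by
  set I := Lagrange.interpolate (range (r + 1))
      (fun k : ℕ => (((s : ℤ) - r + 1 : ℤ) : ℝ) + (k : ℝ) - 1 / 2)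
      (fun k : ℕ => F.eval ((((s : ℤ) - r + 1 : ℤ) : ℝ) + (k : ℝ) - 1 / 2)) with hI
  have hnode : ∀ k ∈ range (r + 1),
      (F - I).eval ((s : ℝ) - r + k + 1 / 2) = 0 := by
    intro k hk
    have := Lagrange.eval_interpolate_at_node
      (fun k : ℕ => F.eval ((((s : ℤ) - r + 1 : ℤ) : ℝ) + (k : ℝ) - 1 / 2))
      (injOn_node ((s : ℤ) - r + 1) r) hk
    rw [← hI] at this
    have e : (s : ℝ) - r + k + 1 / 2 = (((s : ℤ) - r + 1 : ℤ) : ℝ) + (k : ℝ) - 1 / 2 := by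
      push_cast; ring
    rw [eval_sub, e, this, sub_self]
  -- Moving `ξ = 1/2` to the origin makes 0 one of the nodes. As `D 0 = 0`, the error `D' 0` is the
  -- value at 0 of `D / x`, which vanishes at all other nodes.
  set D := (F - I).comp (X + C (1 / 2)) with hD
  have hDnode : ∀ k ∈ range (r + 1), D.eval ((s : ℝ) - r + k) = 0 := by
    intro k hk
    rw [hD, eval_comp, ← hnode k hk]
    simp
  have hD0 : D.eval 0 = 0 := by
    have := hDnode (r - s) (by simp)
    rwa [Nat.cast_sub hs.le, show (s : ℝ) - r + (r - s) = 0 by ring] at this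
  have hIdeg : I.natDegree ≤ r := by
    have := Lagrange.degree_interpolate_lt
      (fun k : ℕ => F.eval ((((s : ℤ) - r + 1 : ℤ) : ℝ) + (k : ℝ) - 1 / 2))
      (injOn_node ((s : ℤ) - r + 1) r)
    rw [← hI, card_range] at this
    exact natDegree_le_iff_coeff_eq_zero.2 fun N hN =>
      coeff_eq_zero_of_degree_lt (this.trans_le (by exact_mod_cast hN))
  have hkey := fwdDiff_iter_eval_of_eval_eq_zero hs D.divX (F.comp (X + C (1 / 2))).divX ?_ ?_
  · have hval : (derivative F).eval (1 / 2)
        - subValue r s (cellMean fun ξ => (derivative F).eval ξ) = D.divX.eval 0 := by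
      rw [subValue, subPoly, reconPoly_cellMean_derivative, ← hI, ← eval_derivative_eq_eval_divX,
        hD, derivative_comp]
      simp
    rw [hval, hkey, idealWeight]
    have hsq : ((-1 : ℝ) ^ s) * (-1) ^ s = 1 := by rw [← mul_pow]; simp
    linear_combination (((r.choose s : ℝ) * ((r - 1).choose s : ℝ)) / ((2 * r - 1).choose r : ℝ)
      * D.divX.eval 0) * (-hsq)
  · have : (F.comp (X + C (1 / 2))).divX - D.divX = (I.comp (X + C (1 / 2))).divX := by
      rw [sub_eq_iff_eq_add, ← divX_add, hD, sub_comp]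
      congr 1
      ring
    rw [this, natDegree_divX_eq_natDegree_tsub_one, natDegree_comp, natDegree_X_add_C]
    omega
  · intro k hk hne
    have h1 := eval_mul_divX D ((s : ℝ) - r + k)
    rw [hDnode k hk, hD0, sub_zero] at h1
    refine (mul_eq_zero.1 h1).resolve_left fun h => hne ?_
    have : (s : ℝ) + k = r := by linarith
    have : s + k = r := by exact_mod_cast this
    omega

/-- The weighted errors carry the signs and binomials of a difference of order `r - 1`, applied to
an `r`-th difference of `H`. Their sum is thus, up to a factor, the difference of order `2r - 1` of
`H` at `-r`, and `H` has degree at most `2r - 2`. -/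
theorem sum_idealWeight_mul_subValue {r : ℕ} (hr : 0 < r) (p : ℝ[X])
    (hp : p.natDegree < 2 * r - 1) :
    ∑ s ∈ range r, idealWeight r s * subValue r s (cellMean fun ξ => p.eval ξ)
      = p.eval (1 / 2) := by
  obtain ⟨F, rfl, hF⟩ := exists_derivative_eq p hp
  set H := (F.comp (X + C (1 / 2))).divX with hH
  have hHdeg : H.natDegree < (r - 1) + r := by
    rw [hH, natDegree_divX_eq_natDegree_tsub_one, natDegree_comp, natDegree_X_add_C]
    omega
  have h0 := congrFun (fwdDiff_iter_eq_zero_of_degree_lt hHdeg) (-(r : ℝ))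
  rw [Function.iterate_add_apply, fwdDiff_iter_eq_sum_shift, Nat.sub_add_cancel hr] at h0
  have hsum : ∑ s ∈ range r, idealWeight r s * ((derivative F).eval (1 / 2)
        - subValue r s (cellMean fun ξ => (derivative F).eval ξ)) = 0 := by
    rw [sum_congr rfl fun s hs => idealWeight_mul_error (mem_range.1 hs) F, ← mul_sum]
    refine mul_eq_zero_of_right _ ?_
    have : ∀ s ∈ range r, (-1 : ℝ) ^ s * (r - 1).choose s *
        (fwdDiff 1)^[r] H.eval ((s : ℝ) - r) = (-1) ^ (r - 1) *
        (((-1 : ℤ) ^ (r - 1 - s) * (r - 1).choose s) •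
          (fwdDiff 1)^[r] H.eval (-(r : ℝ) + s • (1 : ℝ))) := by
      intro s hs
      rw [mem_range] at hs
      rw [nsmul_one, show -(r : ℝ) + s = s - r by ring, zsmul_eq_mul]
      push_cast
      have h2 : (-1 : ℝ) ^ (r - 1) * (-1) ^ (r - 1 - s) = (-1) ^ s := by
        rw [show (-1 : ℝ) ^ (r - 1) = (-1) ^ s * (-1) ^ (r - 1 - s) by
          rw [← pow_add]; congr 1; omega, mul_assoc, ← mul_pow]
        simp
      rw [← h2]
      ring
    rw [sum_congr rfl this, ← mul_sum, h0]
    simp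
  simp only [mul_sub, sum_sub_distrib] at hsum
  rw [← sum_mul, sum_idealWeight hr, one_mul] at hsum
  linarith

/-! ### Stability of the reconstructions -/

theorem eval_iterate_derivative_reconPoly (a : ℤ) (m l : ℕ) (v : ℤ → ℝ) (ξ : ℝ) :
    (derivative^[l] (reconPoly a m v)).eval ξ
      = ∑ k ∈ range (m + 1), (∑ i ∈ range k, v (a + (i : ℤ))) *
        (derivative^[l + 1] (Lagrange.basis (range (m + 1))
          (fun k : ℕ => (a : ℝ) + (k : ℝ) - 1 / 2) k)).eval ξ := by
  rw [reconPoly, ← Function.iterate_succ_apply, Lagrange.interpolate_apply,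
    iterate_derivative_sum, eval_finsetSum]
  exact sum_congr rfl fun k _ => by rw [iterate_derivative_C_mul, eval_C_mul]

/-- A bound for the `l`-th derivative at `ξ` of the reconstruction polynomial from cell averages of
absolute value at most one. -/
noncomputable def reconBound (a : ℤ) (m l : ℕ) (ξ : ℝ) : ℝ :=
  ∑ k ∈ range (m + 1), (k : ℝ) * |(derivative^[l + 1] (Lagrange.basis (range (m + 1))
          (fun k : ℕ => (a : ℝ) + (k : ℝ) - 1 / 2) k)).eval ξ|

theorem reconBound_nonneg (a : ℤ) (m l : ℕ) (ξ : ℝ) : 0 ≤ reconBound a m l ξ :=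
  sum_nonneg fun _ _ => by positivity

theorem continuous_reconBound (a : ℤ) (m l : ℕ) : Continuous (reconBound a m l) :=
  continuous_finsetSum _ fun _ _ => continuous_const.mul (Polynomial.continuous _).abs

theorem abs_eval_iterate_derivative_reconPoly_le {a : ℤ} {m : ℕ} (l : ℕ) {v : ℤ → ℝ} {M : ℝ}
    (hv : ∀ i < m, |v (a + (i : ℤ))| ≤ M) (ξ : ℝ) :
    |(derivative^[l] (reconPoly a m v)).eval ξ| ≤ M * reconBound a m l ξ := by
  rw [eval_iterate_derivative_reconPoly, reconBound, mul_sum]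
  refine (abs_sum_le_sum_abs _ _).trans (sum_le_sum fun k hk => ?_)
  rw [abs_mul, ← mul_assoc]
  refine mul_le_mul_of_nonneg_right ?_ (abs_nonneg _)
  refine (abs_sum_le_sum_abs _ _).trans ?_
  calc ∑ i ∈ range k, |v (a + (i : ℤ))| ≤ ∑ i ∈ range k, M :=
        sum_le_sum fun i hi => hv i (by rw [mem_range] at hi hk; omega)
    _ = M * k := by simp [mul_comm]

theorem reconPoly_sub (a : ℤ) (m : ℕ) (v w : ℤ → ℝ) :
    reconPoly a m (v - w) = reconPoly a m v - reconPoly a m w := by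
  have : (fun k : ℕ => ∑ i ∈ range k, (v - w) (a + (i : ℤ)))
      = (fun k : ℕ => ∑ i ∈ range k, v (a + (i : ℤ)))
        - fun k : ℕ => ∑ i ∈ range k, w (a + (i : ℤ)) := by
    funext k
    simp
  rw [reconPoly, this, map_sub, derivative_sub, reconPoly, reconPoly]

theorem cell_subset {r i : ℤ} (h1 : 1 - r ≤ i) (h2 : i ≤ r - 1) :
    Set.uIcc ((i : ℝ) - 1 / 2) ((i : ℝ) + 1 / 2) ⊆ Set.Icc (-(r : ℝ)) r := by
  have h1' : 1 - (r : ℝ) ≤ i := by exact_mod_cast h1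
  have h2' : (i : ℝ) ≤ r - 1 := by exact_mod_cast h2
  rw [Set.uIcc_of_le (by linarith)]
  exact Set.Icc_subset_Icc (by linarith) (by linarith)

theorem cellMean_sub {r i : ℤ} (h1 : 1 - r ≤ i) (h2 : i ≤ r - 1) {w g : ℝ → ℝ}
    (hw : ContinuousOn w (Set.Icc (-(r : ℝ)) r)) (hg : ContinuousOn g (Set.Icc (-(r : ℝ)) r)) :
    cellMean (w - g) i = cellMean w i - cellMean g i :=
  intervalIntegral.integral_sub (hw.mono (cell_subset h1 h2)).intervalIntegrable
    (hg.mono (cell_subset h1 h2)).intervalIntegrable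

theorem abs_cellMean_le {r i : ℤ} (h1 : 1 - r ≤ i) (h2 : i ≤ r - 1) {w : ℝ → ℝ} {M : ℝ}
    (hM : ∀ ξ ∈ Set.Icc (-(r : ℝ)) r, |w ξ| ≤ M) : |cellMean w i| ≤ M := by
  have := intervalIntegral.norm_integral_le_of_norm_le_const (f := w) (C := M)
    (a := (i : ℝ) - 1 / 2) (b := (i : ℝ) + 1 / 2) fun x hx =>
      hM x (cell_subset h1 h2 (Set.uIoc_subset_uIcc hx))
  rw [Real.norm_eq_abs, show (i : ℝ) + 1 / 2 - (i - 1 / 2) = 1 by ring, abs_one, mul_one] at this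
  exact this

/-- Additivity of `cellMean` is available only on cells inside the window of continuity, so
dependence on those cells alone is needed. -/
theorem subPoly_congr {r s : ℕ} (hs : s < r) {v w : ℤ → ℝ}
    (h : ∀ i : ℤ, 1 - (r : ℤ) ≤ i → i ≤ r - 1 → v i = w i) : subPoly r s v = subPoly r s w := by
  unfold subPoly reconPoly
  congr 1
  refine Lagrange.interpolate_eq_of_values_eq_on _ _ fun k hk => sum_congr rfl fun i hi => h _ ?_ ?_
  · omega
  · rw [mem_range] at hk hi
    omega

theorem abs_subPoly_derivative_le {r s : ℕ} (hs : s < r) (l : ℕ) {w : ℝ → ℝ} {M : ℝ}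
    (hM : ∀ ξ ∈ Set.Icc (-(r : ℝ)) r, |w ξ| ≤ M) (ξ : ℝ) :
    |(derivative^[l] (subPoly r s (cellMean w))).eval ξ|
      ≤ M * reconBound ((s : ℤ) - r + 1) r l ξ := by
  refine abs_eval_iterate_derivative_reconPoly_le l (fun i hi => ?_) ξ
  exact abs_cellMean_le (r := r) (by omega) (by omega) hM

theorem subPoly_cellMean_sub {r s : ℕ} (hs : s < r) {w g : ℝ → ℝ}
    (hw : ContinuousOn w (Set.Icc (-(r : ℝ)) r)) (hg : ContinuousOn g (Set.Icc (-(r : ℝ)) r)) :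
    subPoly r s (cellMean (w - g)) = subPoly r s (cellMean w) - subPoly r s (cellMean g) := by
  rw [subPoly_congr hs (w := cellMean w - cellMean g)
    fun i h1 h2 => cellMean_sub (r := r) h1 h2 hw hg]
  exact reconPoly_sub _ _ _ _

/-- The reconstruction with the ideal weights. -/
noncomputable def linRecon (r : ℕ) (v : ℤ → ℝ) : ℝ :=
  ∑ s ∈ range r, idealWeight r s * subValue r s v

theorem linRecon_cellMean_sub {r : ℕ} {w g : ℝ → ℝ}
    (hw : ContinuousOn w (Set.Icc (-(r : ℝ)) r)) (hg : ContinuousOn g (Set.Icc (-(r : ℝ)) r)) :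
    linRecon r (cellMean (w - g)) = linRecon r (cellMean w) - linRecon r (cellMean g) := by
  rw [linRecon, linRecon, linRecon, ← sum_sub_distrib]
  refine sum_congr rfl fun s hs => ?_
  rw [subValue, subPoly_cellMean_sub (mem_range.1 hs) hw hg, eval_sub, mul_sub, subValue, subValue]

theorem abs_linRecon_le {r : ℕ} {w : ℝ → ℝ} {M : ℝ}
    (hM : ∀ ξ ∈ Set.Icc (-(r : ℝ)) r, |w ξ| ≤ M) :
    |linRecon r (cellMean w)|
      ≤ (∑ s ∈ range r, idealWeight r s * reconBound ((s : ℤ) - r + 1) r 0 (1 / 2)) * M := by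
  rw [linRecon, sum_mul]
  refine (abs_sum_le_sum_abs _ _).trans (sum_le_sum fun s hs => ?_)
  have hs := mem_range.1 hs
  rw [abs_mul, abs_of_pos (idealWeight_pos hs), mul_assoc, mul_comm (reconBound _ _ _ _)]
  exact mul_le_mul_of_nonneg_left (abs_subPoly_derivative_le hs 0 hM _) (idealWeight_pos hs).le

/-- The linear reconstruction is exact on polynomials of degree at most `2r - 2`, so its error is
controlled by the distance to such polynomials. -/
theorem exists_linRecon_error_le {r : ℕ} (hr : 0 < r) :
    ∃ K : ℝ, 0 < K ∧ ∀ (w : ℝ → ℝ) (p : ℝ[X]) (M : ℝ), p.natDegree < 2 * r - 1 →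
      ContinuousOn w (Set.Icc (-(r : ℝ)) r) →
      (∀ ξ ∈ Set.Icc (-(r : ℝ)) r, |w ξ - p.eval ξ| ≤ M) →
      |linRecon r (cellMean w) - w (1 / 2)| ≤ K * M := by
  -- The `+ 1` pays for `|w (1/2) - p (1/2)| ≤ M`.
  refine ⟨(∑ s ∈ range r, idealWeight r s * reconBound ((s : ℤ) - r + 1) r 0 (1 / 2)) + 1, ?_, ?_⟩
  · have : 0 ≤ ∑ s ∈ range r, idealWeight r s * reconBound ((s : ℤ) - r + 1) r 0 (1 / 2) :=
      sum_nonneg fun s hs => mul_nonneg (idealWeight_pos (mem_range.1 hs)).le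
        (reconBound_nonneg _ _ _ _)
    linarith
  intro w p M hp hw hM
  have h1 := linRecon_cellMean_sub hw p.continuous.continuousOn
  have h2 : linRecon r (cellMean fun ξ => p.eval ξ) = p.eval (1 / 2) :=
    sum_idealWeight_mul_subValue hr p hp
  have h3 := abs_linRecon_le (w := w - fun ξ => p.eval ξ) hM
  have hr' : (1 : ℝ) ≤ r := by exact_mod_cast hr
  have h4 := hM (1 / 2) ⟨by linarith, by linarith⟩
  rw [h1, h2] at h3
  rw [add_mul, one_mul]
  calc |linRecon r (cellMean w) - w (1 / 2)|
      = |(linRecon r (cellMean w) - p.eval (1 / 2)) - (w (1 / 2) - p.eval (1 / 2))| := by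
        congr 1; ring
    _ ≤ _ := (abs_sub _ _).trans (add_le_add h3 h4)

/-! ### Comparison of the smoothness indicators -/

/-- The smoothness indicator of a polynomial on the cell `[-1/2, 1/2]`. -/
noncomputable def polySmooth (r : ℕ) (p : ℝ[X]) : ℝ :=
  ∑ l ∈ Icc 1 (r - 1), ∫ ξ in (-(1 / 2) : ℝ)..(1 / 2), ((derivative^[l] p).eval ξ) ^ 2

/-- Young's inequality for the cross term. The part `η * b ^ 2` becomes a relative error of the
indicator, harmless even where the indicator is small. -/
theorem abs_sq_sub_sq_le (a b : ℝ) {η : ℝ} (hη : 0 < η) :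
    |a ^ 2 - b ^ 2| ≤ η * b ^ 2 + (1 + 1 / η) * (a - b) ^ 2 := by
  have h : a ^ 2 - b ^ 2 = (a - b) ^ 2 + 2 * (b * (a - b)) := by ring
  have h1 : 0 ≤ (η * b - (a - b)) ^ 2 / η := by positivity
  have h2 : 0 ≤ (η * b + (a - b)) ^ 2 / η := by positivity
  have e1 : (η * b - (a - b)) ^ 2 / η = η * b ^ 2 - 2 * (b * (a - b)) + 1 / η * (a - b) ^ 2 := by
    field_simp
    ring
  have e2 : (η * b + (a - b)) ^ 2 / η = η * b ^ 2 + 2 * (b * (a - b)) + 1 / η * (a - b) ^ 2 := by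
    field_simp
    ring
  rw [h, abs_le]
  have := sq_nonneg (a - b)
  constructor <;> linarith

theorem abs_polySmooth_sub_le (r : ℕ) (p q : ℝ[X]) {η : ℝ} (hη : 0 < η) :
    |polySmooth r p - polySmooth r q|
      ≤ η * polySmooth r q + (1 + 1 / η) * polySmooth r (p - q) := by
  have hint : ∀ (g : ℝ[X]) (l : ℕ), IntervalIntegrable
      (fun ξ => ((derivative^[l] g).eval ξ) ^ 2) MeasureTheory.volume (-(1 / 2)) (1 / 2) :=
    fun g l => ((derivative^[l] g).continuous.pow 2).intervalIntegrable _ _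
  simp only [polySmooth, mul_sum]
  rw [← sum_sub_distrib, ← sum_add_distrib]
  refine (abs_sum_le_sum_abs _ _).trans (sum_le_sum fun l _ => ?_)
  rw [← intervalIntegral.integral_sub (hint _ _) (hint _ _),
    ← intervalIntegral.integral_const_mul, ← intervalIntegral.integral_const_mul,
    ← intervalIntegral.integral_add ((hint _ _).const_mul _) ((hint _ _).const_mul _)]
  refine (intervalIntegral.abs_integral_le_integral_abs (by norm_num)).trans ?_
  refine intervalIntegral.integral_mono_on (by norm_num) ((hint _ _).sub (hint _ _)).abs
    (((hint _ _).const_mul _).add ((hint _ _).const_mul _)) fun ξ _ => ?_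
  rw [iterate_derivative_sub, eval_sub]
  exact abs_sq_sub_sq_le _ _ hη

theorem polySmooth_subPoly_le {r s : ℕ} (hs : s < r) {w : ℝ → ℝ} {M : ℝ}
    (hM : ∀ ξ ∈ Set.Icc (-(r : ℝ)) r, |w ξ| ≤ M) :
    polySmooth r (subPoly r s (cellMean w)) ≤ (∑ l ∈ Icc 1 (r - 1),
      ∫ ξ in (-(1 / 2) : ℝ)..(1 / 2), (reconBound ((s : ℤ) - r + 1) r l ξ) ^ 2) * M ^ 2 := by
  rw [polySmooth, sum_mul]
  refine sum_le_sum fun l _ => ?_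
  rw [← intervalIntegral.integral_mul_const]
  refine intervalIntegral.integral_mono_on (by norm_num)
    (((derivative^[l] _).continuous.pow 2).intervalIntegrable _ _)
    ((((continuous_reconBound _ _ _).pow 2).mul continuous_const).intervalIntegrable _ _)
    fun ξ _ => ?_
  rw [← mul_pow, mul_comm (reconBound _ _ _ _), ← sq_abs]
  exact pow_le_pow_left₀ (abs_nonneg _) (abs_subPoly_derivative_le hs l hM ξ) 2

/-- A substencil reproduces `p`, so only the reconstruction of `w - p` contributes to the error. The
reference value `polySmooth r p` does not depend on `s`. -/
theorem exists_smoothInd_sub_le (r : ℕ) :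
    ∃ K : ℝ, 0 ≤ K ∧ ∀ s < r, ∀ (w : ℝ → ℝ) (p : ℝ[X]) (M η : ℝ), p.natDegree < r → 0 < η →
      ContinuousOn w (Set.Icc (-(r : ℝ)) r) →
      (∀ ξ ∈ Set.Icc (-(r : ℝ)) r, |w ξ - p.eval ξ| ≤ M) →
      |smoothInd r s (cellMean w) - polySmooth r p|
        ≤ η * polySmooth r p + (1 + 1 / η) * (K * M ^ 2) := by
  have hnn : ∀ s : ℕ, 0 ≤ ∑ l ∈ Icc 1 (r - 1), ∫ ξ in (-(1 / 2) : ℝ)..(1 / 2),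
      (reconBound ((s : ℤ) - r + 1) r l ξ) ^ 2 := fun s => sum_nonneg fun l _ =>
    intervalIntegral.integral_nonneg (by norm_num) fun _ _ => sq_nonneg _
  refine ⟨∑ s ∈ range r, ∑ l ∈ Icc 1 (r - 1), ∫ ξ in (-(1 / 2) : ℝ)..(1 / 2),
    (reconBound ((s : ℤ) - r + 1) r l ξ) ^ 2, sum_nonneg fun s _ => hnn s, ?_⟩
  intro s hs w p M η hp hη hw hM
  refine (abs_polySmooth_sub_le r _ p hη).trans (add_le_add le_rfl ?_)
  refine mul_le_mul_of_nonneg_left ?_ (by positivity)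
  have h1 : subPoly r s (cellMean fun ξ => p.eval ξ) = p := reconPoly_cellMean_eval p _ hp
  have h2 := subPoly_cellMean_sub hs hw (g := fun ξ => p.eval ξ) p.continuous.continuousOn
  rw [h1] at h2
  rw [← h2]
  refine (polySmooth_subPoly_le hs hM).trans (mul_le_mul_of_nonneg_right ?_ (sq_nonneg M))
  exact single_le_sum (f := fun s : ℕ => ∑ l ∈ Icc 1 (r - 1), ∫ ξ in (-(1 / 2) : ℝ)..(1 / 2),
    (reconBound ((s : ℤ) - r + 1) r l ξ) ^ 2) (fun s _ => hnn s) (mem_range.2 hs)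

/-! ### The mapping near the ideal weights -/

theorem minDistIndex_spec {r : ℕ} (hr : 0 < r) (d : ℕ → ℝ) (ω : ℝ) :
    minDistIndex r d ω < r ∧ ∀ i < r, |ω - d (minDistIndex r d ω)| ≤ |ω - d i| := by
  refine Nat.sInf_mem (s := {k : ℕ | k < r ∧ ∀ i < r, |ω - d k| ≤ |ω - d i|}) ?_
  obtain ⟨k, hk, hmin⟩ := exists_min_image (range r) (fun i => |ω - d i|) ⟨0, by simpa using hr⟩
  exact ⟨k, mem_range.1 hk, fun i hi => hmin i (mem_range.2 hi)⟩

/-- Comparing weights instead of indices avoids having to know that the `d i` are distinct. -/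
theorem eventually_minDistIndex {r s : ℕ} (d : ℕ → ℝ) (hs : s < r) :
    ∀ᶠ ω in 𝓝 (d s), d (minDistIndex r d ω) = d s := by
  have h : ∀ᶠ ω in 𝓝 (d s), ∀ i ∈ range r, d i ≠ d s → |ω - d s| < |ω - d i| := by
    refine (Filter.eventually_all_finset _).2 fun i _ => ?_
    by_cases hi : d i = d s
    · simp [hi]
    · have h1 : Filter.Tendsto (fun ω : ℝ => |ω - d s|) (𝓝 (d s)) (𝓝 |d s - d s|) :=
        ((continuous_id.sub continuous_const).abs).tendsto _
      have h2 : Filter.Tendsto (fun ω : ℝ => |ω - d i|) (𝓝 (d s)) (𝓝 |d s - d i|) :=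
        ((continuous_id.sub continuous_const).abs).tendsto _
      filter_upwards [h1.eventually_lt h2 (by
        rw [sub_self, abs_zero, abs_pos]; exact sub_ne_zero.2 (Ne.symm hi))] with ω hω _ using hω
  filter_upwards [h] with ω hω
  obtain ⟨hlt, hmin⟩ := minDistIndex_spec (Nat.zero_lt_of_lt hs) d ω
  by_contra hne
  exact absurd (hmin s hs) (not_le.2 (hω _ (mem_range.2 hlt) hne))

/-- Since `cfs < d < 1`, the point `d` lies in the interior of the plateau. -/
theorem gACMk_eventually_eq {d cfs : ℝ} (k : ℝ) (hd : d < 1) (hpos : 0 < cfs) (hcfs : cfs < d) :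
    ∀ᶠ ω in 𝓝 d, gACMk d cfs k ω = d := by
  have hup : d < 1 - (1 - d) / d * cfs := by
    have hd0 : 0 < d := hpos.trans hcfs
    have : (1 - d) / d * cfs < 1 - d := by
      rw [div_mul_eq_mul_div, div_lt_iff₀ hd0]
      exact mul_lt_mul_of_pos_left hcfs (by linarith)
    linarith
  filter_upwards [lt_mem_nhds hcfs, gt_mem_nhds hup] with ω h1 h2
  rw [gACMk, if_neg (not_lt.2 h1.le), if_pos h2.le]

/-- The selected index may differ from `s` when weights coincide, so the plateau is used for every
`cfs i`; this is where `cfs` below all ideal weights enters. -/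
theorem gMOP_eventually_eq {r s : ℕ} (hr : 2 ≤ r) (hs : s < r) {cfs : ℕ → ℝ} (k : ℕ → ℝ)
    (hcfs_pos : ∀ s < r, 0 < cfs s)
    (hcfs_lt : ∀ s < r, ∀ t < r, cfs s < idealWeight r t) :
    ∀ᶠ ω in 𝓝 (idealWeight r s), gMOP r cfs k ω = idealWeight r s := by
  have h : ∀ᶠ ω in 𝓝 (idealWeight r s), ∀ i ∈ range r,
      gACMk (idealWeight r s) (cfs i) (k i) ω = idealWeight r s :=
    (Filter.eventually_all_finset _).2 fun i hi => gACMk_eventually_eq _ (idealWeight_lt_one hr hs)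
      (hcfs_pos i (mem_range.1 hi)) (hcfs_lt i (mem_range.1 hi) s hs)
  filter_upwards [h, eventually_minDistIndex (idealWeight r) hs] with ω h1 h2
  have hlt := (minDistIndex_spec (by omega : 0 < r) (idealWeight r) ω).1
  rw [gMOP, minDist, minDist, minDist, h2]
  exact h1 _ (mem_range.2 hlt)

/-- If all smoothness indicators are relatively close to a common value, then the mapping restores
the ideal weights exactly. -/
theorem exists_reconstruct_eq_linRecon {r : ℕ} (hr : 2 ≤ r) {cfs : ℕ → ℝ} (k : ℕ → ℝ)
    (hcfs_pos : ∀ s < r, 0 < cfs s)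
    (hcfs_lt : ∀ s < r, ∀ t < r, cfs s < idealWeight r t) :
    ∃ η : ℝ, 0 < η ∧ ∀ (ε B : ℝ) (v : ℤ → ℝ), 0 ≤ ε → 0 < B →
      (∀ s < r, |smoothInd r s v - B| < η * B) →
      reconstruct r ε cfs k v = linRecon r v := by
  have hsum : ∑ l : Fin r, idealWeight r l = 1 := by
    rw [Fin.sum_univ_eq_sum_range (idealWeight r), sum_idealWeight (by omega)]
  -- JS weights are invariant under scaling of all `ε + β_s`; with `q s = (ε + β_s) / (ε + B)`,
  -- continuity at `q = 1` yields an `η` independent of `ε` and `B`.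
  have hev : ∀ᶠ q in 𝓝 (1 : Fin r → ℝ), ∀ s : Fin r,
      gMOP r cfs k (idealWeight r s / q s ^ 2 / ∑ l : Fin r, idealWeight r l / q l ^ 2)
        = idealWeight r s := by
    refine Filter.eventually_all.2 fun s => ?_
    have hq : ∀ l : Fin r, Filter.Tendsto (fun q : Fin r → ℝ => idealWeight r l / q l ^ 2)
        (𝓝 1) (𝓝 (idealWeight r l)) := by
      intro l
      have : Filter.Tendsto (fun q : Fin r → ℝ => q l ^ 2) (𝓝 1) (𝓝 (1 ^ 2)) :=
        ((continuous_apply l).pow 2).tendsto 1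
      have h1 := (tendsto_const_nhds (x := idealWeight r l)).div this (by norm_num)
      rwa [one_pow, div_one] at h1
    have hF := (hq s).div (tendsto_finsetSum univ fun l _ => hq l) (by rw [hsum]; exact one_ne_zero)
    rw [hsum, div_one] at hF
    exact hF.eventually (gMOP_eventually_eq hr s.2 k hcfs_pos hcfs_lt)
  obtain ⟨η, hη, hball⟩ := Metric.eventually_nhds_iff.1 hev
  refine ⟨η, hη, fun ε B v hε hB hv => ?_⟩
  have hεB : 0 < ε + B := by linarith
  have hw : ∀ s : Fin r, gMOP r cfs k (omegaJS r ε v s) = idealWeight r s := by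
    intro s
    have hd : dist (fun s : Fin r => (ε + smoothInd r s v) / (ε + B)) 1 < η := by
      refine (dist_pi_lt_iff hη).2 fun l => ?_
      rw [Pi.one_apply, Real.dist_eq, div_sub_one hεB.ne', abs_div, abs_of_pos hεB,
        div_lt_iff₀ hεB, add_sub_add_left_eq_sub]
      exact (hv l l.2).trans_le (mul_le_mul_of_nonneg_left (by linarith) hη.le)
    rw [← hball hd s]
    congr 1
    have hα : ∀ l : ℕ, idealWeight r l / ((ε + smoothInd r l v) / (ε + B)) ^ 2
        = alphaJS r ε v l * (ε + B) ^ 2 := by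
      intro l
      rw [alphaJS, div_pow, div_div_eq_mul_div, mul_div_right_comm]
    rw [omegaJS]
    simp only [hα]
    rw [← sum_mul, Fin.sum_univ_eq_sum_range (alphaJS r ε v),
      mul_div_mul_right _ _ (by positivity)]
  rw [reconstruct, linRecon]
  have hw' : ∀ s ∈ range r, gMOP r cfs k (omegaJS r ε v s) = idealWeight r s :=
    fun s hs => hw ⟨s, mem_range.1 hs⟩
  refine sum_congr rfl fun s hs => ?_
  rw [omegaMOP, sum_congr rfl hw', sum_idealWeight (by omega), div_one, hw' s hs]

/-! ### Taylor polynomials on shrinking windows -/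

theorem continuousAt_iteratedDeriv {u : ℝ → ℝ} {x : ℝ} {n k : ℕ} (hu : ContDiffAt ℝ n u x)
    (hk : k ≤ n) : ContinuousAt (iteratedDeriv k u) x := by
  rw [iteratedDeriv_eq_equiv_comp]
  have : ContDiffAt ℝ 0 (iteratedFDeriv ℝ k u) x :=
    hu.iteratedFDeriv_right (by rw [zero_add]; exact_mod_cast hk)
  exact (LinearIsometryEquiv.continuous _).continuousAt.comp this.continuousAt

/-- The Taylor polynomial of degree `≤ n` of `u` at `a`. -/
noncomputable def taylorPoly (u : ℝ → ℝ) (n : ℕ) (a : ℝ) : ℝ[X] :=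
  ∑ k ∈ range (n + 1), C (iteratedDeriv k u a / k.factorial) * (X - C a) ^ k

theorem natDegree_taylorPoly_le (u : ℝ → ℝ) (n : ℕ) (a : ℝ) :
    (taylorPoly u n a).natDegree ≤ n := by
  refine natDegree_sum_le_of_forall_le _ _ fun k hk => ?_
  refine (natDegree_C_mul_le _ _).trans ?_
  rw [natDegree_pow, natDegree_X_sub_C, mul_one]
  exact Nat.lt_succ_iff.1 (mem_range.1 hk)

theorem exists_taylorPoly_error_le {u : ℝ → ℝ} {xc : ℝ} {n : ℕ}
    (hu : ContDiffAt ℝ ((n + 1 : ℕ) : WithTop ℕ∞) u xc) :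
    ∃ M δ : ℝ, 0 < M ∧ 0 < δ ∧ ∀ a x : ℝ, |a - xc| < δ → |x - xc| < δ → a ≤ x →
      |u x - (taylorPoly u n a).eval x| ≤ M * (x - a) ^ (n + 1) := by
  have hb : ∀ᶠ y in 𝓝 xc, |iteratedDeriv (n + 1) u y| < |iteratedDeriv (n + 1) u xc| + 1 :=
    (continuousAt_iteratedDeriv hu le_rfl).abs.eventually (gt_mem_nhds (lt_add_one _))
  obtain ⟨δ, hδ, hball⟩ := Metric.eventually_nhds_iff.1 (hb.and (hu.eventually (by simp)))
  refine ⟨|iteratedDeriv (n + 1) u xc| + 1, δ / 2, by positivity, by positivity, ?_⟩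
  intro a x ha hx hax
  rw [abs_lt] at ha hx
  -- A fixed right end keeps the Taylor interval nondegenerate and the bound uniform in `a` and `x`.
  set b := xc + δ / 2 with hbdef
  have hab : a < b := by linarith
  have hmem : ∀ y ∈ Set.Icc a b, dist y xc < δ := by
    intro y hy
    rw [Real.dist_eq, abs_lt]
    exact ⟨by linarith [hy.1], by linarith [hy.2]⟩
  have hcd : ∀ y ∈ Set.Icc a b, ContDiffAt ℝ ((n + 1 : ℕ) : WithTop ℕ∞) u y :=
    fun y hy => (hball (hmem y hy)).2
  have hwithin : ∀ k ≤ n + 1, ∀ y ∈ Set.Icc a b,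
      iteratedDerivWithin k u (Set.Icc a b) y = iteratedDeriv k u y := fun k hk y hy =>
    iteratedDerivWithin_eq_iteratedDeriv (uniqueDiffOn_Icc hab)
      ((hcd y hy).of_le (by exact_mod_cast hk)) hy
  have hamem : a ∈ Set.Icc a b := ⟨le_rfl, hab.le⟩
  have h := taylor_mean_remainder_bound (n := n) (x := x) hab.le
    (fun y hy => ((hcd y hy).contDiffWithinAt : ContDiffWithinAt ℝ ((n + 1 : ℕ) : WithTop ℕ∞) u _ y))
    ⟨hax, by linarith⟩ (C := |iteratedDeriv (n + 1) u xc| + 1) fun y hy => by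
      rw [hwithin _ le_rfl y hy, Real.norm_eq_abs]
      exact (hball (hmem y hy)).1.le
  have heval : taylorWithinEval u n (Set.Icc a b) a x = (taylorPoly u n a).eval x := by
    rw [taylor_within_apply, taylorPoly, eval_finsetSum]
    refine sum_congr rfl fun k hk => ?_
    rw [hwithin k (mem_range.1 hk).le a hamem]
    simp
    ring
  rw [heval, Real.norm_eq_abs] at h
  refine h.trans (div_le_self (mul_nonneg (by positivity) (pow_nonneg (by linarith) _)) ?_)
  exact_mod_cast Nat.one_le_iff_ne_zero.2 n.factorial_ne_zero

theorem eval_iterate_derivative_taylorPoly (u : ℝ → ℝ) (n l : ℕ) (a x : ℝ) :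
    (derivative^[l] (taylorPoly u n a)).eval x = ∑ k ∈ range (n + 1),
      iteratedDeriv k u a / k.factorial * (k.descFactorial l * (x - a) ^ (k - l)) := by
  rw [taylorPoly, iterate_derivative_sum, eval_finsetSum]
  refine sum_congr rfl fun k _ => ?_
  rw [iterate_derivative_C_mul, iterate_derivative_X_sub_pow]
  simp

/-- The derivative is continuous at `(xc, xc)` in base point and argument, with value `iteratedDeriv
l u xc` there. -/
theorem exists_le_abs_derivative_taylorPoly {u : ℝ → ℝ} {xc : ℝ} {n l : ℕ}
    (hu : ContDiffAt ℝ n u xc) (hl : l ≤ n) (hne : iteratedDeriv l u xc ≠ 0) :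
    ∃ m δ : ℝ, 0 < m ∧ 0 < δ ∧ ∀ a x : ℝ, |a - xc| < δ → |x - xc| < δ →
      m ≤ |(derivative^[l] (taylorPoly u n a)).eval x| := by
  have hcont : ContinuousAt (fun z : ℝ × ℝ => |(derivative^[l] (taylorPoly u n z.1)).eval z.2|)
      (xc, xc) := by
    simp only [eval_iterate_derivative_taylorPoly]
    refine (tendsto_finsetSum _ fun k hk => ?_).abs
    have hk : ContinuousAt (iteratedDeriv k u) xc :=
      continuousAt_iteratedDeriv hu (Nat.lt_succ_iff.1 (mem_range.1 hk))
    have h1 : ContinuousAt (fun z : ℝ × ℝ => iteratedDeriv k u z.1) (xc, xc) :=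
      ContinuousAt.comp (f := Prod.fst) (x := (xc, xc)) hk continuousAt_fst
    exact (h1.div_const _).mul (by fun_prop)
  have hval : (derivative^[l] (taylorPoly u n xc)).eval xc = iteratedDeriv l u xc := by
    rw [eval_iterate_derivative_taylorPoly, sum_eq_single_of_mem l (by simpa using hl)]
    · rw [Nat.descFactorial_self, Nat.sub_self, pow_zero, mul_one]
      exact div_mul_cancel₀ _ (by exact_mod_cast l.factorial_ne_zero)
    · intro k _ hkl
      rcases lt_or_gt_of_ne hkl with h | h
      · simp [Nat.descFactorial_of_lt h]
      · simp [Nat.sub_ne_zero_of_lt h]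
  have hpos : 0 < |iteratedDeriv l u xc| := abs_pos.2 hne
  have hev := hcont.eventually (lt_mem_nhds (show |iteratedDeriv l u xc| / 2
    < |(derivative^[l] (taylorPoly u n xc)).eval xc| by rw [hval]; linarith))
  obtain ⟨δ, hδ, hball⟩ := Metric.eventually_nhds_iff.1 hev
  refine ⟨_, δ, half_pos hpos, hδ, fun a x ha hx => (hball (y := (a, x)) ?_).le⟩
  exact max_lt ha hx

theorem iterate_derivative_comp_linear (p : ℝ[X]) (c h : ℝ) (l : ℕ) :
    derivative^[l] (p.comp (C c + C h * X)) = C (h ^ l) * (derivative^[l] p).comp (C c + C h * X) := by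
  induction l with
  | zero => simp
  | succ l ih =>
    rw [Function.iterate_succ_apply', ih, derivative_C_mul, derivative_comp,
      Function.iterate_succ_apply', pow_succ, C_mul]
    simp
    ring

/-- On the window `|ξ| ≤ W` around `c`, the function `u (c + h ξ)` is approximated by the Taylor
polynomial of `u` at the left end of the window. -/
noncomputable def windowPoly (u : ℝ → ℝ) (n : ℕ) (W c h : ℝ) : ℝ[X] :=
  (taylorPoly u n (c - W * |h|)).comp (C c + C h * X)

theorem natDegree_windowPoly_le (u : ℝ → ℝ) (n : ℕ) (W c h : ℝ) :
    (windowPoly u n W c h).natDegree ≤ n := by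
  refine natDegree_comp_le.trans ?_
  have h1 : (C c + C h * X : ℝ[X]).natDegree ≤ 1 := by
    rw [add_comm]
    exact natDegree_linear_le
  exact (Nat.mul_le_mul (natDegree_taylorPoly_le u n _) h1).trans (mul_one n).le

theorem abs_mul_le_of_mem {W h ξ : ℝ} (hξ : ξ ∈ Set.Icc (-W) W) : |h * ξ| ≤ W * |h| := by
  rw [abs_mul, mul_comm]
  exact mul_le_mul_of_nonneg_right (abs_le.2 hξ) (abs_nonneg h)

theorem eventually_nhds_of_abs_lt {P : ℝ → ℝ → Prop} {xc h₀ δ : ℝ} (hh₀ : 0 < h₀) (hδ : 0 < δ)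
    (hP : ∀ c h : ℝ, |h| < h₀ → |c - xc| < δ → P c h) :
    ∀ᶠ z : ℝ × ℝ in 𝓝 (xc, 0), P z.1 z.2 := by
  refine Metric.eventually_nhds_iff.2 ⟨min h₀ δ, lt_min hh₀ hδ, fun {z} hz => ?_⟩
  obtain ⟨h1, h2⟩ := max_lt_iff.1 hz
  rw [Real.dist_eq] at h1 h2
  rw [sub_zero] at h2
  exact hP _ _ (h2.trans_le (min_le_left _ _)) (h1.trans_le (min_le_right _ _))

/-- A window of relative width `W` around a point near `xc` stays near `xc`. -/
theorem abs_window_sub_lt {W δ xc c h y : ℝ} (hW : 0 < W) (hh : |h| < δ / (2 * W))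
    (hc : |c - xc| < δ / 2) (hy : |y| ≤ W * |h|) : |c + y - xc| < δ := by
  rw [lt_div_iff₀ (by positivity)] at hh
  calc |c + y - xc| = |(c - xc) + y| := by congr 1; ring
    _ ≤ |c - xc| + |y| := abs_add_le _ _
    _ < δ := by linarith

/-- Distances from the left end of the window are at most `2 * W * |h|`. The sign of `h` is free, so
that mirrored stencils are covered. -/
theorem exists_windowPoly_error_le {u : ℝ → ℝ} {xc : ℝ} {n : ℕ}
    (hu : ContDiffAt ℝ ((n + 1 : ℕ) : WithTop ℕ∞) u xc) {W : ℝ} (hW : 0 < W) :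
    ∃ M : ℝ, 0 < M ∧ ∀ᶠ z : ℝ × ℝ in 𝓝 (xc, 0), ∀ ξ ∈ Set.Icc (-W) W,
      |u (z.1 + z.2 * ξ) - (windowPoly u n W z.1 z.2).eval ξ| ≤ M * |z.2| ^ (n + 1) := by
  obtain ⟨M, δ, hM, hδ, hT⟩ := exists_taylorPoly_error_le hu
  refine ⟨M * (2 * W) ^ (n + 1), by positivity, eventually_nhds_of_abs_lt (P := fun c h =>
    ∀ ξ ∈ Set.Icc (-W) W, |u (c + h * ξ) - (windowPoly u n W c h).eval ξ|
      ≤ M * (2 * W) ^ (n + 1) * |h| ^ (n + 1)) (h₀ := δ / (2 * W)) (δ := δ / 2)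
    (by positivity) (by positivity) fun c h hh hc ξ hξ => ?_⟩
  have hy := abs_mul_le_of_mem (h := h) hξ
  have hle : c - W * |h| ≤ c + h * ξ := by linarith [(abs_le.1 hy).1]
  have ha : |c - W * |h| - xc| < δ := by
    have := abs_window_sub_lt (y := -(W * |h|)) hW hh hc (by
      rw [abs_neg, abs_of_nonneg (by positivity)])
    rwa [← sub_eq_add_neg] at this
  have h1 := hT _ _ ha (abs_window_sub_lt hW hh hc hy) hle
  have h2 : (windowPoly u n W c h).eval ξ
      = (taylorPoly u n (c - W * |h|)).eval (c + h * ξ) := by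
    simp [windowPoly, eval_comp]
  rw [h2]
  refine h1.trans ?_
  rw [mul_assoc, ← mul_pow]
  refine mul_le_mul_of_nonneg_left (pow_le_pow_left₀ (by linarith) ?_ _) hM.le
  linarith [(abs_le.1 hy).2]

/-- The `l`-th derivative alone suffices: rescaling gives it a factor `h ^ l`, and the other
summands are nonnegative. -/
theorem exists_le_polySmooth_windowPoly {u : ℝ → ℝ} {xc : ℝ} {n l : ℕ}
    (hu : ContDiffAt ℝ n u xc) (hl1 : 1 ≤ l) (hl : l ≤ n)
    (hne : iteratedDeriv l u xc ≠ 0) {W : ℝ} (hW : 1 ≤ W) :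
    ∃ m : ℝ, 0 < m ∧ ∀ᶠ z : ℝ × ℝ in 𝓝 (xc, 0),
      m * |z.2| ^ (2 * l) ≤ polySmooth (n + 1) (windowPoly u n W z.1 z.2) := by
  obtain ⟨m, δ, hm, hδ, hT⟩ := exists_le_abs_derivative_taylorPoly hu hl hne
  have hW0 : 0 < W := by linarith
  refine ⟨m ^ 2, by positivity, eventually_nhds_of_abs_lt (P := fun c h =>
    m ^ 2 * |h| ^ (2 * l) ≤ polySmooth (n + 1) (windowPoly u n W c h)) (h₀ := δ / (2 * W))
    (δ := δ / 2) (by positivity) (by positivity) fun c h hh hc => ?_⟩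
  have ha : |c - W * |h| - xc| < δ := by
    have := abs_window_sub_lt (y := -(W * |h|)) hW0 hh hc (by
      rw [abs_neg, abs_of_nonneg (by positivity)])
    rwa [← sub_eq_add_neg] at this
  have hle : ∀ ξ ∈ Set.Icc (-(1 / 2) : ℝ) (1 / 2), m ^ 2 * |h| ^ (2 * l)
      ≤ ((derivative^[l] (windowPoly u n W c h)).eval ξ) ^ 2 := by
    intro ξ hξ
    have hξW : ξ ∈ Set.Icc (-W) W := ⟨by linarith [hξ.1], by linarith [hξ.2]⟩
    have h1 := hT _ _ ha (abs_window_sub_lt hW0 hh hc (abs_mul_le_of_mem (h := h) hξW))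
    rw [windowPoly, iterate_derivative_comp_linear, eval_C_mul, mul_pow, ← sq_abs (eval _ _),
      ← pow_mul, mul_comm l 2, pow_mul, pow_mul, sq_abs, mul_comm]
    refine mul_le_mul_of_nonneg_left (pow_le_pow_left₀ hm.le ?_ 2) (by positivity)
    simpa [eval_comp] using h1
  have hint : m ^ 2 * |h| ^ (2 * l) ≤ ∫ ξ in (-(1 / 2) : ℝ)..(1 / 2),
      ((derivative^[l] (windowPoly u n W c h)).eval ξ) ^ 2 := by
    have := intervalIntegral.integral_mono_on (by norm_num : (-(1 / 2) : ℝ) ≤ 1 / 2)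
      (intervalIntegrable_const (μ := MeasureTheory.volume) (c := m ^ 2 * |h| ^ (2 * l)))
      (((derivative^[l] (windowPoly u n W c h)).continuous.pow 2).intervalIntegrable _ _) hle
    rw [intervalIntegral.integral_const] at this
    norm_num at this
    exact this
  refine hint.trans ?_
  rw [polySmooth, Nat.add_sub_cancel]
  exact single_le_sum (f := fun l => ∫ ξ in (-(1 / 2) : ℝ)..(1 / 2),
      ((derivative^[l] (windowPoly u n W c h)).eval ξ) ^ 2)
    (fun l _ => intervalIntegral.integral_nonneg (by norm_num) fun _ _ => sq_nonneg _)
    (mem_Icc.2 ⟨hl1, hl⟩)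

theorem eventually_continuousOn_window {u : ℝ → ℝ} {xc : ℝ} {n : ℕ} (hu : ContDiffAt ℝ n u xc)
    {W : ℝ} (hW : 0 < W) :
    ∀ᶠ z : ℝ × ℝ in 𝓝 (xc, 0),
      ContinuousOn (fun ξ => u (z.1 + z.2 * ξ)) (Set.Icc (-W) W) := by
  obtain ⟨δ, hδ, hball⟩ := Metric.eventually_nhds_iff.1 (hu.eventually (by simp))
  refine eventually_nhds_of_abs_lt (P := fun c h =>
    ContinuousOn (fun ξ => u (c + h * ξ)) (Set.Icc (-W) W)) (h₀ := δ / (2 * W)) (δ := δ / 2)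
    (by positivity) (by positivity) fun c h hh hc ξ hξ => ?_
  have h1 := (hball (abs_window_sub_lt hW hh hc (abs_mul_le_of_mem (h := h) hξ))).continuousAt
  exact (ContinuousAt.comp (f := fun ξ => c + h * ξ) h1 (by fun_prop)).continuousWithinAt

/-! ### Coincidence with the linear scheme -/

theorem eventually_reconstruct_eq_linRecon {r l : ℕ} (hl1 : 1 ≤ l) (hl : l ≤ r - 1)
    {cfs : ℕ → ℝ} (k : ℕ → ℝ) (hcfs_pos : ∀ s < r, 0 < cfs s)
    (hcfs_lt : ∀ s < r, ∀ t < r, cfs s < idealWeight r t) {u : ℝ → ℝ} {xc : ℝ}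
    (hu : ContDiffAt ℝ r u xc) (hne : iteratedDeriv l u xc ≠ 0) :
    ∀ᶠ z : ℝ × ℝ in 𝓝 (xc, 0), z.2 ≠ 0 → ∀ ε : ℝ, 0 ≤ ε →
      reconstruct r ε cfs k (cellMean fun ξ => u (z.1 + z.2 * ξ))
        = linRecon r (cellMean fun ξ => u (z.1 + z.2 * ξ)) := by
  obtain ⟨n, rfl⟩ : ∃ n, r = n + 1 := ⟨r - 1, by omega⟩
  rw [Nat.add_sub_cancel] at hl
  have hW : (1 : ℝ) ≤ ((n + 1 : ℕ) : ℝ) := by exact_mod_cast Nat.succ_pos n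
  have hW0 : (0 : ℝ) < ((n + 1 : ℕ) : ℝ) := by linarith
  obtain ⟨η, hη, hrec⟩ := exists_reconstruct_eq_linRecon (by omega) k hcfs_pos hcfs_lt
  obtain ⟨K, hK, hsm⟩ := exists_smoothInd_sub_le (n + 1)
  obtain ⟨M, hM, hwin⟩ := exists_windowPoly_error_le hu hW0
  obtain ⟨m, hm, hlow⟩ := exists_le_polySmooth_windowPoly (n := n)
    (hu.of_le (by exact_mod_cast Nat.le_succ n)) hl1 hl hne hW
  have hcont := eventually_continuousOn_window hu hW0
  have hsnd : Filter.Tendsto (fun z : ℝ × ℝ => z.2) (𝓝 (xc, 0)) (𝓝 0) :=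
    continuous_snd.tendsto (xc, 0)
  have habs : ∀ᶠ z : ℝ × ℝ in 𝓝 (xc, 0), |z.2| < 1 :=
    hsnd.abs.eventually (gt_mem_nhds (by simp))
  have hsmall : ∀ᶠ z : ℝ × ℝ in 𝓝 (xc, 0),
      (1 + 1 / (η / 2)) * (K * M ^ 2) * |z.2| ^ 2 < η / 2 * m :=
    ((hsnd.abs.pow 2).const_mul _).eventually (gt_mem_nhds (by simp; positivity))
  filter_upwards [hwin, hlow, hcont, habs, hsmall] with z h1 h2 h3 h4 h5 hz ε hε
  set B := polySmooth (n + 1) (windowPoly u n ((n + 1 : ℕ) : ℝ) z.1 z.2)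
  have hz' : 0 < |z.2| := abs_pos.2 hz
  -- Since `|h| < 1` and `l ≤ n = r - 1`, the lower bound can be weakened to the exponent `2 * n`,
  -- two below that of the squared remainder.
  have hB : m * |z.2| ^ (2 * n) ≤ B := (mul_le_mul_of_nonneg_left
    (pow_le_pow_of_le_one hz'.le h4.le (by omega)) hm.le).trans h2
  have hBpos : 0 < B := lt_of_lt_of_le (by positivity) hB
  refine hrec ε B _ hε hBpos fun s hs => ?_
  -- Half of `η` goes to the relative error, half to the remainder, which `hsmall` absorbs.
  have h6 := hsm s hs (fun ξ => u (z.1 + z.2 * ξ)) _ _ (η / 2)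
    (Nat.lt_succ_of_le (natDegree_windowPoly_le u n _ z.1 z.2)) (half_pos hη) h3 h1
  refine h6.trans_lt ?_
  have h7 : (1 + 1 / (η / 2)) * (K * (M * |z.2| ^ (n + 1)) ^ 2)
      = (1 + 1 / (η / 2)) * (K * M ^ 2) * |z.2| ^ 2 * |z.2| ^ (2 * n) := by ring
  have h8 : (1 + 1 / (η / 2)) * (K * M ^ 2) * |z.2| ^ 2 * |z.2| ^ (2 * n)
      < η / 2 * m * |z.2| ^ (2 * n) := mul_lt_mul_of_pos_right h5 (by positivity)
  have h9 : η / 2 * (m * |z.2| ^ (2 * n)) ≤ η / 2 * B := mul_le_mul_of_nonneg_left hB (by positivity)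
  rw [h7]
  linarith

/-! ### Error of the linear reconstruction -/

/-- The error at the right boundary of the linear reconstruction, on the cell with centre `c` and
(signed) width `h`. -/
noncomputable def linError (r : ℕ) (u : ℝ → ℝ) (c h : ℝ) : ℝ :=
  linRecon r (cellMean fun ξ => u (c + h * ξ)) - u (c + h * (1 / 2))

theorem exists_linError_le {r : ℕ} (hr : 0 < r) {u : ℝ → ℝ} {xc : ℝ}
    (hu : ContDiffAt ℝ ((2 * r - 1 : ℕ) : WithTop ℕ∞) u xc) :
    ∃ K : ℝ, 0 < K ∧ ∀ᶠ z : ℝ × ℝ in 𝓝 (xc, 0),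
      |linError r u z.1 z.2| ≤ K * |z.2| ^ (2 * r - 1) := by
  have hW : (0 : ℝ) < r := by exact_mod_cast hr
  obtain ⟨n, hn⟩ : ∃ n, 2 * r - 1 = n + 1 := ⟨2 * r - 2, by omega⟩
  rw [hn] at hu ⊢
  obtain ⟨M, hM, hwin⟩ := exists_windowPoly_error_le hu hW
  obtain ⟨K, hK, hlin⟩ := exists_linRecon_error_le hr
  refine ⟨K * M, by positivity, ?_⟩
  filter_upwards [hwin, eventually_continuousOn_window hu hW] with z h1 h2
  rw [mul_assoc]
  refine hlin _ (windowPoly u n r z.1 z.2) _ ?_ h2 h1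
  rw [hn]
  exact Nat.lt_succ_of_le (natDegree_windowPoly_le _ _ _ _ _)

/-- The leading terms cancel; `0 < n` handles constants, whose difference still has `natDegree` 0.
-/
theorem natDegree_comp_X_add_one_sub_lt {p : ℝ[X]} {n : ℕ} (hp : p.natDegree ≤ n) (hn : 0 < n) :
    (p.comp (X + C 1) - p).natDegree < n := by
  by_cases h0 : p.natDegree = 0
  · obtain ⟨a, ha⟩ := natDegree_eq_zero.1 h0
    simpa [← ha] using hn
  have hp0 : p ≠ 0 := fun h => h0 (by simp [h])
  have hdeg : (p.comp (X + C 1)).natDegree = p.natDegree := by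
    rw [natDegree_comp, natDegree_X_add_C, mul_one]
  have hc0 : p.comp (X + C 1) ≠ 0 := fun h => h0 (by rw [← hdeg, h, natDegree_zero])
  have hlt := degree_sub_lt_left (p := p.comp (X + C 1)) (q := p)
    (by rw [degree_eq_natDegree hc0, degree_eq_natDegree hp0, hdeg]) hc0
    (by rw [leadingCoeff_comp (by rw [natDegree_X_add_C]; exact one_ne_zero),
      leadingCoeff_X_add_C, one_pow, mul_one])
  rw [degree_eq_natDegree hc0, hdeg] at hlt
  by_cases hs : p.comp (X + C 1) - p = 0
  · rw [hs, natDegree_zero]; exact hn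
  · exact ((natDegree_lt_iff_degree_lt hs).2 hlt).trans_le hp

/-- The errors at the two boundaries of a cell agree to one order more. -/
theorem exists_linError_sub_le {r : ℕ} (hr : 0 < r) {u : ℝ → ℝ} {xc : ℝ}
    (hu : ContDiffAt ℝ ((2 * r : ℕ) : WithTop ℕ∞) u xc) :
    ∃ K : ℝ, 0 < K ∧ ∀ᶠ z : ℝ × ℝ in 𝓝 (xc, 0),
      |linError r u (z.1 + z.2) z.2 - linError r u z.1 z.2| ≤ K * |z.2| ^ (2 * r) := by
  -- One extra unit lets the same window contain the stencil shifted by one cell.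
  have hW : (0 : ℝ) < (r : ℝ) + 1 := by positivity
  obtain ⟨n, hn⟩ : ∃ n, 2 * r = n + 1 := ⟨2 * r - 1, by omega⟩
  rw [hn] at hu ⊢
  obtain ⟨M, hM, hwin⟩ := exists_windowPoly_error_le hu hW
  obtain ⟨K, hK, hlin⟩ := exists_linRecon_error_le hr
  refine ⟨K * (2 * M), by positivity, ?_⟩
  filter_upwards [hwin, eventually_continuousOn_window hu hW] with z h1 h2
  set P := windowPoly u n ((r : ℝ) + 1) z.1 z.2 with hP
  set w : ℝ → ℝ := fun ξ => u (z.1 + z.2 * ξ) with hw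
  set w1 : ℝ → ℝ := fun ξ => u (z.1 + z.2 + z.2 * ξ) with hw1
  have hshift : ∀ ξ, w1 ξ = w (ξ + 1) := fun ξ => by
    simp only [hw, hw1]
    congr 1
    ring
  have hm0 : ∀ ξ ∈ Set.Icc (-(r : ℝ)) r, ξ ∈ Set.Icc (-((r : ℝ) + 1)) ((r : ℝ) + 1) :=
    fun ξ hξ => ⟨by linarith [hξ.1], by linarith [hξ.2]⟩
  have hm1 : ∀ ξ ∈ Set.Icc (-(r : ℝ)) r, ξ + 1 ∈ Set.Icc (-((r : ℝ) + 1)) ((r : ℝ) + 1) :=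
    fun ξ hξ => ⟨by linarith [hξ.1], by linarith [hξ.2]⟩
  have hwc : ContinuousOn w (Set.Icc (-(r : ℝ)) r) := h2.mono hm0
  have hw1c : ContinuousOn w1 (Set.Icc (-(r : ℝ)) r) := by
    rw [show w1 = fun ξ => w (ξ + 1) from funext hshift]
    exact h2.comp (by fun_prop) hm1
  -- The difference of the errors is the error for `w1 - w`. A unit difference lowers the degree `2r
  -- - 1` of `P` into the range of exactness.
  have hdeg : (P.comp (X + C 1) - P).natDegree < 2 * r - 1 :=
    natDegree_comp_X_add_one_sub_lt ((natDegree_windowPoly_le _ _ _ _ _).trans (by omega))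
      (by omega)
  have h3 := hlin (w1 - w) _ (2 * (M * |z.2| ^ (n + 1))) hdeg (hw1c.sub hwc) fun ξ hξ => by
    have e1 := h1 ξ (hm0 ξ hξ)
    have e2 := h1 (ξ + 1) (hm1 ξ hξ)
    have e3 : (w1 - w) ξ - (P.comp (X + C 1) - P).eval ξ
        = (w (ξ + 1) - P.eval (ξ + 1)) - (w ξ - P.eval ξ) := by
      rw [Pi.sub_apply, hshift, eval_sub, eval_comp]
      simp only [eval_add, eval_X, eval_C]
      ring
    rw [e3, two_mul]
    exact (abs_sub _ _).trans (add_le_add e2 e1)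
  rw [linRecon_cellMean_sub hw1c hwc, Pi.sub_apply] at h3
  calc _ = |linRecon r (cellMean w1) - linRecon r (cellMean w) - (w1 (1 / 2) - w (1 / 2))| := by
        simp only [linError, hw, hw1]
        congr 1
        ring
    _ ≤ K * (2 * (M * |z.2| ^ (n + 1))) := h3
    _ = _ := by ring

/-! ### Flux differences and passage to the grid -/

/-- Replacing `p` by `q` costs the Lipschitz constant of `f`; then `t ↦ f (a + t) - f (b + t)` has
slope at most that of `deriv f` times `|a - b|`. Both `p - q` and `a - b` supply the extra power of
`h`. -/
theorem exists_flux_difference_le {f : ℝ → ℝ} {U : ℝ} (hf : ContDiffAt ℝ 2 f U) :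
    ∃ L ρ : ℝ, 0 < L ∧ 0 < ρ ∧ ∀ a b p q : ℝ, |a - U| < ρ → |b - U| < ρ → |p| < ρ → |q| < ρ →
      |(f (a + p) - f a) - (f (b + q) - f b)| ≤ L * (|p - q| + |a - b| * |q|) := by
  obtain ⟨K1, t1, ht1, hL1⟩ := (hf.of_le one_le_two).exists_lipschitzOnWith
  have hf' : ContDiffAt ℝ 1 (deriv f) U :=
    (hf.fderiv_right (m := 1) (by norm_num)).clm_apply contDiffAt_const
  obtain ⟨K2, t2, ht2, hL2⟩ := hf'.exists_lipschitzOnWith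
  obtain ⟨ρ, hρ, hball⟩ := Metric.eventually_nhds_iff.1
    ((Filter.Eventually.and ht1 ht2).and (hf.eventually (by simp)))
  have hmem : ∀ a p : ℝ, |a - U| < ρ / 2 → |p| < ρ / 2 → dist (a + p) U < ρ := by
    intro a p ha hp
    rw [Real.dist_eq, show a + p - U = (a - U) + p by ring]
    linarith [abs_add_le (a - U) p]
  refine ⟨K1 + K2 + 1, ρ / 2, by positivity, by positivity, fun a b p q ha hb hp hq => ?_⟩
  have h1 : |f (a + p) - f (a + q)| ≤ K1 * |p - q| := by
    have := hL1.dist_le_mul _ (hball (hmem a p ha hp)).1.1 _ (hball (hmem a q ha hq)).1.1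
    rwa [Real.dist_eq, Real.dist_eq, add_sub_add_left_eq_sub] at this
  have hderiv : ∀ c : ℝ, |c - U| < ρ / 2 → ∀ t ∈ Metric.ball (0 : ℝ) (ρ / 2),
      HasDerivAt (fun t => f (c + t)) (deriv f (c + t)) t := by
    intro c hc t ht
    rw [mem_ball_zero_iff] at ht
    have := ((hball (hmem c t hc ht)).2.differentiableAt (by norm_num)).hasDerivAt
    exact this.comp_const_add c t
  have h2 := (convex_ball (0 : ℝ) (ρ / 2)).norm_image_sub_le_of_norm_hasDerivWithin_le
    (f := fun t => f (a + t) - f (b + t)) (f' := fun t => deriv f (a + t) - deriv f (b + t))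
    (C := K2 * |a - b|) (x := 0) (y := q)
    (fun t ht => ((hderiv a ha t ht).sub (hderiv b hb t ht)).hasDerivWithinAt)
    (fun t ht => by
      rw [mem_ball_zero_iff] at ht
      have := hL2.dist_le_mul _ (hball (hmem a t ha ht)).1.2 _ (hball (hmem b t hb ht)).1.2
      rwa [Real.dist_eq, Real.dist_eq, add_sub_add_right_eq_sub] at this)
    (by simpa using hρ) (by simpa using hq)
  rw [Real.norm_eq_abs, Real.norm_eq_abs, add_zero, add_zero, sub_zero] at h2
  have hK1 : (0 : ℝ) ≤ K1 := K1.2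
  have hK2 : (0 : ℝ) ≤ K2 := K2.2
  calc |(f (a + p) - f a) - (f (b + q) - f b)|
      = |(f (a + p) - f (a + q)) + (f (a + q) - f (b + q) - (f a - f b))| := by congr 1; ring
    _ ≤ K1 * |p - q| + K2 * |a - b| * |q| := (abs_add_le _ _).trans (add_le_add h1 h2)
    _ ≤ _ := by
      have e1 : 0 ≤ (K2 + 1 : ℝ) * |p - q| := by positivity
      have e2 : 0 ≤ (K1 + 1 : ℝ) * (|a - b| * |q|) := by positivity
      linarith

theorem cellAvg_add (u : ℝ → ℝ) (xl : ℝ) {h : ℝ} (hh : h ≠ 0) (j i : ℤ) :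
    cellAvg u xl h (j + i) = cellMean (fun ξ => u (cellCenter xl h j + h * ξ)) i := by
  rw [cellMean, intervalIntegral.integral_comp_add_mul u hh, cellAvg, smul_eq_mul, one_div]
  congr 2 <;> (simp only [cellCenter]; push_cast; ring)

/-- Mirroring at the cell boundary means taking the next cell's centre and width `-h`; the signs
from `1 / h` and the orientation cancel. -/
theorem cellAvg_sub (u : ℝ → ℝ) (xl : ℝ) {h : ℝ} (hh : h ≠ 0) (j i : ℤ) :
    cellAvg u xl h (j + 1 - i) = cellMean (fun ξ => u (cellCenter xl h j + h + -h * ξ)) i := by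
  rw [cellMean, intervalIntegral.integral_comp_add_mul u (neg_ne_zero.2 hh),
    intervalIntegral.integral_symm, cellAvg, smul_eq_mul, one_div, inv_neg, neg_mul_neg]
  congr 2 <;> (simp only [cellCenter]; push_cast; ring)

theorem uMinus_cellAvg (r : ℕ) (ε : ℝ) (cfs k : ℕ → ℝ) (u : ℝ → ℝ) (xl : ℝ) {h : ℝ} (hh : h ≠ 0)
    (j : ℤ) : uMinus r ε cfs k (cellAvg u xl h) j
      = reconstruct r ε cfs k (cellMean fun ξ => u (cellCenter xl h j + h * ξ)) := by
  rw [uMinus]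
  exact congrArg _ (funext (cellAvg_add u xl hh j))

theorem uPlus_cellAvg (r : ℕ) (ε : ℝ) (cfs k : ℕ → ℝ) (u : ℝ → ℝ) (xl : ℝ) {h : ℝ} (hh : h ≠ 0)
    (j : ℤ) : uPlus r ε cfs k (cellAvg u xl h) j
      = reconstruct r ε cfs k (cellMean fun ξ => u (cellCenter xl h j + h + -h * ξ)) := by
  rw [uPlus]
  exact congrArg _ (funext (cellAvg_sub u xl hh j))

theorem cellCenter_sub_one (xl h : ℝ) (j : ℤ) :
    cellCenter xl h (j - 1) = cellCenter xl h j - h := by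
  simp only [cellCenter]
  push_cast
  ring

/-- The Lax–Friedrichs fluxes of perturbed states at the two boundaries of a cell. -/
theorem abs_lxFlux_sub_le {f : ℝ → ℝ} {α L a b p₁ p₀ q₁ q₀ : ℝ}
    (hp : |(f (a + p₁) - f a) - (f (b + p₀) - f b)| ≤ L * (|p₁ - p₀| + |a - b| * |p₀|))
    (hq : |(f (a + q₁) - f a) - (f (b + q₀) - f b)| ≤ L * (|q₁ - q₀| + |a - b| * |q₀|)) :
    |(lxFlux f α (a + p₁) (a + q₁) - lxFlux f α (b + p₀) (b + q₀)) - (f a - f b)|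
      ≤ (L * (|p₁ - p₀| + |a - b| * |p₀|) + L * (|q₁ - q₀| + |a - b| * |q₀|)
          + |α| * (|q₁ - q₀| + |p₁ - p₀|)) / 2 := by
  have hα : |α * ((q₁ - q₀) - (p₁ - p₀))| ≤ |α| * (|q₁ - q₀| + |p₁ - p₀|) := by
    rw [abs_mul]
    exact mul_le_mul_of_nonneg_left (abs_sub _ _) (abs_nonneg _)
  have e : (lxFlux f α (a + p₁) (a + q₁) - lxFlux f α (b + p₀) (b + q₀)) - (f a - f b)
      = (((f (a + p₁) - f a) - (f (b + p₀) - f b)) + ((f (a + q₁) - f a) - (f (b + q₀) - f b))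
          - α * ((q₁ - q₀) - (p₁ - p₀))) / 2 := by
    simp only [lxFlux]
    ring
  rw [e, abs_div, abs_two]
  refine div_le_div_of_nonneg_right ?_ (by norm_num)
  exact (abs_sub _ _).trans (add_le_add ((abs_add_le _ _).trans (add_le_add hp hq)) hα)

end MopWeno

/-! ### The main theorem -/

theorem mainTheorem10 (r ncp : ℕ) (hncp : ncp < r - 1)
    (cfs k : ℕ → ℝ)
    (hcfs_pos : ∀ s < r, 0 < cfs s)
    (hcfs_lt : ∀ s < r, ∀ t < r, cfs s < MopWeno.idealWeight r t)
    (hk : ∀ s < r, k s ∈ Set.Icc 0 (MopWeno.idealWeight r s / cfs s))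
    (u f : ℝ → ℝ) (xc α : ℝ)
    (hu : ContDiffAt ℝ ((2 * r : ℕ) : WithTop ℕ∞) u xc)
    (hf : ContDiffAt ℝ 2 f (u xc))
    (hcrit : MopWeno.IsCritOrder u ncp xc) :
    ∃ C h₀ δ : ℝ, 0 < C ∧ 0 < h₀ ∧ 0 < δ ∧
      ∀ ε h xl : ℝ, 0 ≤ ε → 0 < h → h < h₀ →
        ∀ j : ℤ, |MopWeno.cellCenter xl h j - xc| < δ →
          |MopWeno.uMinus r ε cfs k (MopWeno.cellAvg u xl h) j
              - u (MopWeno.cellCenter xl h j + h / 2)| ≤ C * h ^ (2 * r - 1) ∧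
          |MopWeno.uPlus r ε cfs k (MopWeno.cellAvg u xl h) j
              - u (MopWeno.cellCenter xl h j + h / 2)| ≤ C * h ^ (2 * r - 1) ∧
          |MopWeno.schemeOp r ε cfs k f α h (MopWeno.cellAvg u xl h) j
              - (-(1 / h) * (f (u (MopWeno.cellCenter xl h j + h / 2))
                  - f (u (MopWeno.cellCenter xl h j - h / 2))))| ≤ C * h ^ (2 * r - 1) := by
  open MopWeno Topology in
  have hr : 0 < r := by omega
  have hA := eventually_reconstruct_eq_linRecon (l := ncp + 1) (by omega) (by omega) k hcfs_pos
    hcfs_lt (hu.of_le (by exact_mod_cast (by omega : r ≤ 2 * r))) hcrit.2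
  obtain ⟨K1, hK1, hB1⟩ := exists_linError_le hr
    (hu.of_le (by exact_mod_cast (by omega : 2 * r - 1 ≤ 2 * r)))
  obtain ⟨K2, hK2, hB2⟩ := exists_linError_sub_le hr hu
  obtain ⟨L, ρ, hL, hρ, hflux⟩ := exists_flux_difference_le hf
  obtain ⟨Lu, t, ht, hLu⟩ := (hu.of_le (m := 1) (by
    exact_mod_cast (by omega : 1 ≤ 2 * r))).exists_lipschitzOnWith
  have hρ1 : ∀ᶠ z : ℝ × ℝ in 𝓝 (xc, 0), K1 * |z.2| ^ (2 * r - 1) < ρ := by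
    have hc : Continuous fun z : ℝ × ℝ => K1 * |z.2| ^ (2 * r - 1) := by fun_prop
    refine (hc.tendsto (xc, 0)).eventually (gt_mem_nhds ?_)
    simpa [show 2 * r - 1 ≠ 0 by omega] using hρ
  have hU : ∀ᶠ z : ℝ × ℝ in 𝓝 (xc, 0), |u (z.1 + z.2 / 2) - u xc| < ρ ∧ z.1 + z.2 / 2 ∈ t := by
    have hc : Filter.Tendsto (fun z : ℝ × ℝ => z.1 + z.2 / 2) (𝓝 (xc, 0)) (𝓝 xc) := by
      have : Continuous fun z : ℝ × ℝ => z.1 + z.2 / 2 := by fun_prop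
      simpa using this.tendsto (xc, 0)
    have hρu : ∀ᶠ y in 𝓝 xc, |u y - u xc| < ρ :=
      hu.continuousAt.eventually (Metric.ball_mem_nhds _ hρ)
    have htu : ∀ᶠ y in 𝓝 xc, y ∈ t := ht
    exact hc.eventually (hρu.and htu)
  have hgood := hA.and (hB1.and hB2)
  -- With `(x, h)`, the pairs `(x + h, -h)`, `(x - h, h)` and `(x, -h)` describe the four
  -- reconstructions at the two boundaries.
  have t1 : Filter.Tendsto (fun z : ℝ × ℝ => (z.1 + z.2, -z.2)) (𝓝 (xc, 0)) (𝓝 (xc, 0)) := by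
    have : Continuous fun z : ℝ × ℝ => (z.1 + z.2, -z.2) := by fun_prop
    simpa using this.tendsto (xc, 0)
  have t2 : Filter.Tendsto (fun z : ℝ × ℝ => (z.1 - z.2, z.2)) (𝓝 (xc, 0)) (𝓝 (xc, 0)) := by
    have : Continuous fun z : ℝ × ℝ => (z.1 - z.2, z.2) := by fun_prop
    simpa using this.tendsto (xc, 0)
  have t3 : Filter.Tendsto (fun z : ℝ × ℝ => (z.1, -z.2)) (𝓝 (xc, 0)) (𝓝 (xc, 0)) := by
    have : Continuous fun z : ℝ × ℝ => (z.1, -z.2) := by fun_prop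
    simpa using this.tendsto (xc, 0)
  obtain ⟨δ, hδ, hball⟩ := Metric.eventually_nhds_iff.1 (hgood.and ((t1.eventually hgood).and
    ((t2.eventually hgood).and ((t3.eventually hgood).and
      (hρ1.and (hU.and (t3.eventually hU)))))))
  have hLu0 : (0 : ℝ) ≤ Lu := Lu.2
  -- `K1` serves the point values; the bracket bounds the flux difference divided by `h ^ (2 * r)`.
  refine ⟨K1 + (L * (K2 + Lu * K1) + |α| * K2), δ, δ, by positivity, hδ, hδ, ?_⟩
  intro ε h xl hε hh hh₀ j hj
  have hdist : dist (cellCenter xl h j, h) (xc, 0) < δ :=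
    max_lt hj (by rwa [Real.dist_eq, sub_zero, abs_of_pos hh])
  obtain ⟨⟨A1, B1, -⟩, ⟨A2, B2, D2⟩, ⟨A3, B3, D3⟩, ⟨A4, B4, -⟩, hsmall, ⟨hU1, hU1t⟩, hU0, hU0t⟩ :=
    hball hdist
  have hne := hh.ne'
  have hm1 := uMinus_cellAvg r ε cfs k u xl hne j
  have hp1 := uPlus_cellAvg r ε cfs k u xl hne j
  have hm0 := uMinus_cellAvg r ε cfs k u xl hne (j - 1)
  have hp0 := uPlus_cellAvg r ε cfs k u xl hne (j - 1)
  rw [cellCenter_sub_one] at hm0 hp0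
  rw [sub_add_cancel] at hp0
  simp only [schemeOp, numFlux]
  generalize cellCenter xl h j = x at *
  simp only [abs_neg, abs_of_pos hh, sub_add_cancel, add_sub_cancel_right, neg_div,
    ← sub_eq_add_neg] at B1 B2 B3 B4 D2 D3 hsmall hU0 hU0t
  rw [A1 hne ε hε] at hm1
  rw [A2 (neg_ne_zero.2 hne) ε hε] at hp1
  rw [A3 hne ε hε] at hm0
  rw [A4 (neg_ne_zero.2 hne) ε hε] at hp0
  have em1 : uMinus r ε cfs k (cellAvg u xl h) j = u (x + h / 2) + linError r u x h := by
    rw [hm1, linError, mul_one_div, add_sub_cancel]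
  have ep1 : uPlus r ε cfs k (cellAvg u xl h) j = u (x + h / 2) + linError r u (x + h) (-h) := by
    rw [hp1, linError, show x + h + -h * (1 / 2) = x + h / 2 by ring, add_sub_cancel]
  have em0 : uMinus r ε cfs k (cellAvg u xl h) (j - 1)
      = u (x - h / 2) + linError r u (x - h) h := by
    rw [hm0, linError, show x - h + h * (1 / 2) = x - h / 2 by ring, add_sub_cancel]
  have ep0 : uPlus r ε cfs k (cellAvg u xl h) (j - 1) = u (x - h / 2) + linError r u x (-h) := by
    rw [hp0, linError, show x + -h * (1 / 2) = x - h / 2 by ring, add_sub_cancel]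
  rw [em1, ep1, em0, ep0, add_sub_cancel_left, add_sub_cancel_left]
  have hpow : 0 < h ^ (2 * r - 1) := by positivity
  have hC : K1 * h ^ (2 * r - 1)
      ≤ (K1 + (L * (K2 + Lu * K1) + |α| * K2)) * h ^ (2 * r - 1) :=
    mul_le_mul_of_nonneg_right (le_add_of_nonneg_right (by positivity)) hpow.le
  refine ⟨B1.trans hC, B2.trans hC, ?_⟩
  rw [abs_sub_comm] at D2
  have hab : |u (x + h / 2) - u (x - h / 2)| ≤ Lu * h := by
    have := hLu.dist_le_mul _ hU1t _ hU0t
    rwa [Real.dist_eq, Real.dist_eq, show x + h / 2 - (x - h / 2) = h by ring, abs_of_pos hh]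
      at this
  have hmain := abs_lxFlux_sub_le (α := α)
    (hflux _ _ _ _ hU1 hU0 (B1.trans_lt hsmall) (B3.trans_lt hsmall))
    (hflux _ _ _ _ hU1 hU0 (B2.trans_lt hsmall) (B4.trans_lt hsmall))
  have hprod : ∀ e : ℝ, |e| ≤ K1 * h ^ (2 * r - 1) →
      |u (x + h / 2) - u (x - h / 2)| * |e| ≤ Lu * K1 * h ^ (2 * r) := by
    intro e he
    refine (mul_le_mul hab he (abs_nonneg _) (by positivity)).trans_eq ?_
    rw [show 2 * r = (2 * r - 1) + 1 by omega, Nat.add_sub_cancel]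
    ring
  have hbound : (L * (|linError r u x h - linError r u (x - h) h|
        + |u (x + h / 2) - u (x - h / 2)| * |linError r u (x - h) h|)
      + L * (|linError r u (x + h) (-h) - linError r u x (-h)|
        + |u (x + h / 2) - u (x - h / 2)| * |linError r u x (-h)|)
      + |α| * (|linError r u (x + h) (-h) - linError r u x (-h)|
        + |linError r u x h - linError r u (x - h) h|)) / 2
      ≤ (L * (K2 + Lu * K1) + |α| * K2) * h ^ (2 * r) := by
    have i1 := mul_le_mul_of_nonneg_left (add_le_add D3 (hprod _ B3)) hL.le
    have i2 := mul_le_mul_of_nonneg_left (add_le_add D2 (hprod _ B4)) hL.le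
    have i3 := mul_le_mul_of_nonneg_left (add_le_add D2 D3) (abs_nonneg α)
    linarith
  rw [← mul_sub, abs_mul, abs_neg, abs_of_pos (by positivity : 0 < 1 / h), one_div]
  refine (mul_le_mul_of_nonneg_left (hmain.trans hbound) (by positivity)).trans ?_
  have hpow2 : h ^ (2 * r) = h ^ (2 * r - 1) * h := by
    rw [← pow_succ, Nat.sub_add_cancel (by omega)]
  rw [hpow2, mul_left_comm, mul_comm (h ^ (2 * r - 1)) h, inv_mul_cancel_left₀ hne]
  exact mul_le_mul_of_nonneg_right (le_add_of_nonneg_left hK1.le) hpow.le
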